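/- Let $\mathcal N=\omega^\omega$ be Baire space, whose elements are called reals, and let $\le_T$, $\equiv_T$ be Turing reducibility and equivalence. A set $A\subseteq\mathcal N$ is cofinal in the Turing degrees if for every $x\in\mathcal N$ there is $y\in A$ with $x\le_T y$. For a recursive ordinal $\rho\ge 1$ write $x\equiv_\rho y$ if $x$ is a $\Delta^0_\rho(y)$ real and $y$ is a $\Delta^0_\rho(x)$ real. Here $x$ is a $\Delta^0_\rho(y)$ real if its graph, as a set of (coded) pairs of natural numbers, and the complement of its graph are both $\Sigma^0_\rho(y)$; the $\Sigma^0_1(y)$ subsets of $\omega$ are those recursively enumerable in $y$, and for $\rho>1$ the $\Sigma^0_\rho(y)$ sets are the unions of $y$-effective sequences of complements of sets from the levels $\Sigma^0_\eta(y)$, $1\le\eta<\rho$ (that is, the sets with a $\Sigma^0_\rho$ Borel code recursive in $y$). For a class $\Gamma$ of sets of reals and an ordinal $2\le\rho<\omega_1^{\mathsf{CK}}$, let $\text{Weak-Turing-Det}_\rho(\Gamma)$ be the statement: for every set $A\in\Gamma$ cofinal in the Turing degrees there are $x,y\in A$ with $x\not\equiv_T y$ and $x\equiv_\rho y$. Theorem.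 Let $2\le\rho<\omega_1^{\mathsf{CK}}$. Then $\text{Weak-Turing-Det}_\rho(\Delta^1_1)$ implies $\text{Weak-Turing-Det}_\rho(\Sigma^1_1)$, where $\Delta^1_1$ and $\Sigma^1_1$ are the lightface classes of subsets of $\mathcal N$. -/

import Mathlib

namespace WeakTuring

/-- The reals: points of Baire space. -/
abbrev Baire : Type := ℕ → ℕ

/-- Turing reducibility of (total) reals. -/
def TuringLE (x y : Baire) : Prop :=
  TuringReducible (fun n => Part.some (x n)) (fun n => Part.some (y n))

/-- Turing equivalence of reals. -/
def TuringEq (x y : Baire) : Prop := TuringLE x y ∧ TuringLE y x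

/-- `A` is cofinal in the Turing degrees. -/
def CofinalInDegrees (A : Set Baire) : Prop := ∀ x : Baire, ∃ y ∈ A, TuringLE x y

/-! ### Lightface classes of sets of reals -/

/-- The finite sequence `s` is an initial segment of the real `x`,
i.e. `x` lies in the basic neighbourhood given by `s`. -/
def IsInitial (s : List ℕ) (x : Baire) : Prop := List.ofFn (fun i : Fin s.length => x i) = s

/-- Lightface `Σ⁰₁` (semirecursive) subsets of the product of two copies of Baire space:
recursively enumerable unions of basic open sets. -/
def IsSigma01Rel (P : Set (Baire × Baire)) : Prop :=
  ∃ W : List ℕ × List ℕ → Prop, REPred W ∧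
    P = {p | ∃ s t : List ℕ, W (s, t) ∧ IsInitial s p.1 ∧ IsInitial t p.2}

/-- Lightface `Π⁰₁` subsets of the product of two copies of Baire space. -/
def IsPi01Rel (P : Set (Baire × Baire)) : Prop := IsSigma01Rel Pᶜ

/-- Lightface `Σ¹₁` sets of reals: projections of lightface `Π⁰₁` sets. -/
def IsSigma11 (A : Set Baire) : Prop :=
  ∃ P : Set (Baire × Baire), IsPi01Rel P ∧ A = {x | ∃ y, (x, y) ∈ P}

/-- Lightface `Δ¹₁` sets of reals. -/
def IsDelta11 (A : Set Baire) : Prop := IsSigma11 A ∧ IsSigma11 Aᶜ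

/-! ### Recursive ordinals -/

/-- `α` is the order type of a recursive well-ordering of a recursive set of natural numbers. -/
def IsRecursiveOrdinal (α : Ordinal.{0}) : Prop :=
  ∃ (D : ℕ → Prop) (r : ℕ → ℕ → Prop),
    ComputablePred D ∧ ComputablePred (fun p : ℕ × ℕ => r p.1 p.2) ∧
      ∃ _ : IsWellOrder {n : ℕ // D n} (fun a b => r a b),
        Ordinal.type (fun a b : {n : ℕ // D n} => r a b) = α

/-- The Church–Kleene ordinal: the least ordinal that is not recursive. -/
noncomputable def omega1CK : Ordinal.{0} := sInf {α | ¬ IsRecursiveOrdinal α}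

/-! ### The effective Borel hierarchy on sets of natural numbers -/

/-- The `i`-th real coded in `c` (the value `c 0` is kept as a label). -/
def subcode (c : Baire) (i : ℕ) : Baire := fun m => c (Nat.pair i m + 1)

/-- `IsSigmaCode ξ c A`: the real `c` is a Borel code, of level (at most) `ξ`, of the `Σ⁰_ξ` set
`A ⊆ ℕ`. Label `0`: `c` enumerates `A`, the value `n + 1` putting `n` into `A` and the value `0`
putting nothing in. Other labels: `c` codes a sequence of codes of levels `η i < ξ` of sets `B i`,
and `A` is the union of the complements of the `B i`. All levels are at least `1`. -/
inductive IsSigmaCode : Ordinal.{0} → Baire → Set ℕ → Prop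
  | enum (c : Baire) (h : c 0 = 0) : IsSigmaCode 1 c {n | ∃ i, c (i + 1) = n + 1}
  | union (ξ : Ordinal.{0}) (c : Baire) (η : ℕ → Ordinal.{0}) (B : ℕ → Set ℕ) (h : c 0 ≠ 0)
      (hη : ∀ i, η i < ξ) (hB : ∀ i, IsSigmaCode (η i) (subcode c i) (B i)) :
      IsSigmaCode ξ c (⋃ i, (B i)ᶜ)

/-- `A ⊆ ℕ` is `Σ⁰_ξ(y)`: it has a `Σ⁰_ξ` code recursive in `y`. -/
def IsSigma0In (ξ : Ordinal.{0}) (y : Baire) (A : Set ℕ) : Prop :=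
  ∃ c : Baire, TuringLE c y ∧ IsSigmaCode ξ c A

/-- `A ⊆ ℕ` is `Δ⁰_ξ(y)`. -/
def IsDelta0In (ξ : Ordinal.{0}) (y : Baire) (A : Set ℕ) : Prop :=
  IsSigma0In ξ y A ∧ IsSigma0In ξ y Aᶜ

/-- The graph of a real, as a set of natural numbers. -/
def graph (x : Baire) : Set ℕ := {k | x k.unpair.1 = k.unpair.2}

/-- `x ≡_ρ y`: each of `x`, `y` is a `Δ⁰_ρ` real relative to the other. -/
def DeltaEquiv (ρ : Ordinal.{0}) (x y : Baire) : Prop :=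
  IsDelta0In ρ y (graph x) ∧ IsDelta0In ρ x (graph y)

/-- `Weak-Turing-Det_ρ(Γ)`. -/
def WeakTuringDet (ρ : Ordinal.{0}) (Γ : Set Baire → Prop) : Prop :=
  ∀ A : Set Baire, Γ A → CofinalInDegrees A →
    ∃ x ∈ A, ∃ y ∈ A, ¬ TuringEq x y ∧ DeltaEquiv ρ x y

end WeakTuring

/-!
Suppose that a cofinal `Σ¹₁` set `A` has no two elements related by
`R x y :↔ x ≢_T y ∧ x ≡_ρ y`. The relation `R` is symmetric and lightface `Σ¹₁`, so `A` reflects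
to a `Δ¹₁` set `B ⊇ A` without such pairs (`exists_isDelta11_superset`): separate `A` from the
`Σ¹₁` set of reals related to elements of `A` by a `Δ¹₁` set `C`, then separate `A` from the `Σ¹₁`
set of reals related to elements of `C` by a `Δ¹₁` set `D`, and take `B = C ∩ D`. Being a superset of `A`, the set `B` is cofinal,
which contradicts the hypothesis on `Δ¹₁` sets.

Two facts carry this. The first is the separation theorem for lightface `Σ¹₁` sets
(`SigmaOneOne.exists_separation`). Membership in the two sets is the existence of a branch through
trees `T x` and `S x`, which are never both ill-founded; the separating set consists of the `x`
with `rank (S x) < rank (T x)`, where an ill-founded tree has rank `∞`.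
That inequality and its negation are both expressed by the existence of a tree homomorphism, hence
are `Σ¹₁` (`exists_isTreeHom_nonroot_iff`).

The second is that `R` is `Σ¹₁`. For Turing reducibility and its negation, the evaluation of all
oracle programs on a given oracle is the unique solution of an arithmetical system of clauses
(`IsOracleEvaluation`), so that `x ≤_T y` is `Δ¹₁` (`deltaOneOne_turingLE`). For `Δ⁰_ρ`, a real is
a Borel code of level `ρ` exactly when its subcodes can be labelled by decreasing elements of a
recursive well-ordering of type `ρ` and by the sets that they code
(`isSigmaCode_iff_exists_isCodeEvaluation`).

Definability is computed with relations between an element of a primitive recursively coded type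
and one real, which holds several reals through the recursive join. On these, `PiZeroOne`,
`SigmaOneOne` and `DeltaOneOne` have the usual closure properties; `IsSigma11.sigmaOneOne` and
`SigmaOneOne.isSigma11` connect them with the classes of sets of reals.
-/

namespace WeakTuring

open Encodable

/-! ### Primitive recursive terms -/

section PrimrecRules

variable {α β γ : Type*} [Primcodable α] [Primcodable β] [Primcodable γ]

theorem primrec_id' : Primrec (fun x : α => x) := Primrec.id

theorem primrec_const' (b : β) : Primrec (fun _ : α => b) := Primrec.const b

theorem primrec_comp' {f : β → γ} {g : α → β} (hf : Primrec f) (hg : Primrec g) :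
    Primrec (fun x => f (g x)) := hf.comp hg

theorem primrec_fst' {f : α → β × γ} (hf : Primrec f) : Primrec (fun x => (f x).1) :=
  Primrec.fst.comp hf

theorem primrec_snd' {f : α → β × γ} (hf : Primrec f) : Primrec (fun x => (f x).2) :=
  Primrec.snd.comp hf

theorem primrec_pair' {f : α → β} {g : α → γ} (hf : Primrec f) (hg : Primrec g) :
    Primrec (fun x => (f x, g x)) := hf.pair hg

theorem primrec_add' {f g : α → ℕ} (hf : Primrec f) (hg : Primrec g) :
    Primrec (fun x => f x + g x) := Primrec.nat_add.comp hf hg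

theorem primrec_mul' {f g : α → ℕ} (hf : Primrec f) (hg : Primrec g) :
    Primrec (fun x => f x * g x) := Primrec.nat_mul.comp hf hg

theorem primrec_div' {f g : α → ℕ} (hf : Primrec f) (hg : Primrec g) :
    Primrec (fun x => f x / g x) := Primrec.nat_div.comp hf hg

theorem primrec_mod' {f g : α → ℕ} (hf : Primrec f) (hg : Primrec g) :
    Primrec (fun x => f x % g x) := Primrec.nat_mod.comp hf hg

theorem primrec_natPair' {f g : α → ℕ} (hf : Primrec f) (hg : Primrec g) :
    Primrec (fun x => Nat.pair (f x) (g x)) := Primrec₂.natPair.comp hf hg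

theorem primrec_unpair' {f : α → ℕ} (hf : Primrec f) : Primrec (fun x => (f x).unpair) :=
  Primrec.unpair.comp hf

theorem primrec_cons' {f : α → β} {g : α → List β} (hf : Primrec f) (hg : Primrec g) :
    Primrec (fun x => f x :: g x) := Primrec.list_cons.comp hf hg

theorem primrec_append' {f g : α → List β} (hf : Primrec f) (hg : Primrec g) :
    Primrec (fun x => f x ++ g x) := Primrec.list_append.comp hf hg

theorem primrec_length' {f : α → List β} (hf : Primrec f) : Primrec (fun x => (f x).length) :=
  Primrec.list_length.comp hf

theorem primrec_take' {f : α → ℕ} {g : α → List β} (hf : Primrec f) (hg : Primrec g) :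
    Primrec (fun x => (g x).take (f x)) := Primrec.list_take.comp hf hg

theorem primrec_drop' {f : α → ℕ} {g : α → List β} (hf : Primrec f) (hg : Primrec g) :
    Primrec (fun x => (g x).drop (f x)) := Primrec.list_drop.comp hf hg

theorem primrec_range' {f : α → ℕ} (hf : Primrec f) : Primrec (fun x => List.range (f x)) :=
  Primrec.list_range.comp hf

theorem primrec_getD' {f : α → List β} {g : α → ℕ} (d : β) (hf : Primrec f) (hg : Primrec g) :
    Primrec (fun x => (f x).getD (g x) d) := (Primrec.list_getD d).comp hf hg

theorem primrec_encode' {f : α → β} (hf : Primrec f) : Primrec (fun x => encode (f x)) :=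
  Primrec.encode.comp hf

theorem primrec_map' {f : α → List β} {g : α → β → γ} (hf : Primrec f)
    (hg : Primrec (fun p : α × β => g p.1 p.2)) : Primrec (fun x => (f x).map (g x)) :=
  Primrec.list_map hf hg.to₂

theorem primrec_decode_getD' {f : α → ℕ} (d : β) (hf : Primrec f) :
    Primrec (fun x => (decode (α := β) (f x)).getD d) :=
  Primrec.option_getD.comp (Primrec.decode.comp hf) (Primrec.const d)

theorem primrec_parity_ite {f : α → ℕ} {g h : α → β} (hf : Primrec f) (hg : Primrec g)
    (hh : Primrec h) : Primrec (fun x => if f x % 2 = 0 then g x else h x) :=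
  Primrec.ite (Primrec.eq.comp (Primrec.nat_mod.comp hf (Primrec.const 2)) (Primrec.const 0)) hg hh

theorem primrec_reverse' {f : α → List β} (hf : Primrec f) : Primrec (fun x => (f x).reverse) :=
  Primrec.list_reverse.comp hf

-- Primitive recursiveness of the terms below is then decided by `fun_prop`.
attribute [fun_prop] Primrec
attribute [fun_prop] primrec_id' primrec_const' primrec_comp' primrec_fst' primrec_snd'
  primrec_pair' primrec_add' primrec_mul' primrec_div' primrec_mod'
  primrec_natPair' primrec_unpair' primrec_cons' primrec_append' primrec_length' primrec_take'
  primrec_drop' primrec_range' primrec_getD' primrec_encode' primrec_map' primrec_decode_getD'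
  primrec_parity_ite primrec_reverse'

theorem primrecPred_eq {f g : α → β} (hf : Primrec f) (hg : Primrec g) :
    PrimrecPred (fun a => f a = g a) := by
  classical
  exact Primrec.eq.comp hf hg

theorem primrecPred_le {f g : α → ℕ} (hf : Primrec f) (hg : Primrec g) :
    PrimrecPred (fun a => f a ≤ g a) := Primrec.nat_le.comp hf hg

theorem primrecPred_lt {f g : α → ℕ} (hf : Primrec f) (hg : Primrec g) :
    PrimrecPred (fun a => f a < g a) := Primrec.nat_lt.comp hf hg

end PrimrecRules

/-! ### Joins of reals -/

/-- The recursive join: `x` at the even places, `y` at the odd ones. -/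
def joinReal (x y : Baire) : Baire := fun n => if n % 2 = 0 then x (n / 2) else y (n / 2)

/-- The even half of a real. -/
def leftHalf (z : Baire) : Baire := fun n => z (2 * n)

/-- The odd half of a real. -/
def rightHalf (z : Baire) : Baire := fun n => z (2 * n + 1)

@[simp] theorem leftHalf_joinReal (x y : Baire) : leftHalf (joinReal x y) = x := by
  funext n; simp [leftHalf, joinReal]

@[simp] theorem rightHalf_joinReal (x y : Baire) : rightHalf (joinReal x y) = y := by
  funext n
  have h1 : (2 * n + 1) % 2 = 1 := by omega
  have h2 : (2 * n + 1) / 2 = n := by omega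
  simp [rightHalf, joinReal, h1, h2]

@[simp] theorem joinReal_two_mul (x y : Baire) (n : ℕ) : joinReal x y (2 * n) = x n :=
  congrFun (leftHalf_joinReal x y) n

@[simp] theorem joinReal_two_mul_add_one (x y : Baire) (n : ℕ) :
    joinReal x y (2 * n + 1) = y n :=
  congrFun (rightHalf_joinReal x y) n

theorem joinReal_comp (x y : Baire) (f g : ℕ → ℕ) :
    joinReal (fun n => x (f n)) (fun n => y (g n)) =
      fun n => joinReal x y (if n % 2 = 0 then 2 * f (n / 2) else 2 * g (n / 2) + 1) := by
  funext n
  by_cases h : n % 2 = 0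
  · simp only [h, if_true, joinReal_two_mul]; simp [joinReal, h]
  · simp only [h, if_false, joinReal_two_mul_add_one]; simp [joinReal, h]

theorem joinReal_joinReal (x z y : Baire) :
    joinReal (joinReal x z) y = fun n => joinReal x (joinReal z y)
      (if n % 2 = 0 then (if n / 2 % 2 = 0 then 2 * (n / 2 / 2) else 2 * (2 * (n / 2 / 2)) + 1)
        else 2 * (2 * (n / 2) + 1) + 1) := by
  funext n
  by_cases h : n % 2 = 0
  · by_cases h' : n / 2 % 2 = 0
    · simp only [h, h', if_true, joinReal_two_mul]; simp [joinReal, h, h']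
    · simp only [h, h', if_true, if_false, joinReal_two_mul_add_one, joinReal_two_mul]
      simp [joinReal, h, h']
  · simp only [h, if_false, joinReal_two_mul_add_one]; simp [joinReal, h]

/-! ### The class `Π⁰₁` of relations between numbers and reals -/

/-- Lightface `Π⁰₁` relations between an element of a primitive recursively coded type and a real:
for every `n`, a primitive recursive condition holds of the values of the real at the places listed
by `L a n`. Query lists, unlike initial segments, are stable under recursive substitutions. -/
def PiZeroOne {α : Type} [Primcodable α] (p : α → Baire → Prop) : Prop :=
  ∃ (L : α × ℕ → List ℕ) (Q : (α × ℕ) × List ℕ → Prop), Primrec L ∧ PrimrecPred Q ∧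
    ∀ a x, p a x ↔ ∀ n, Q ((a, n), (L (a, n)).map x)

section Classes

variable {α β : Type} [Primcodable α] [Primcodable β]

namespace PiZeroOne

theorem atom {L : α → List ℕ} {R : α × List ℕ → Prop} (hL : Primrec L) (hR : PrimrecPred R) :
    PiZeroOne (fun a x => R (a, (L a).map x)) :=
  ⟨fun q => L q.1, fun q => R (q.1.1, q.2), by fun_prop,
    hR.comp (f := fun q : (α × ℕ) × List ℕ => (q.1.1, q.2)) (by fun_prop), by simp⟩

/-- Substitution of a primitive recursive term for the number, and of a real whose `n`-th value is
read off `x` at a primitive recursive place for the real. -/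
theorem subst {p : α → Baire → Prop} (hp : PiZeroOne p) {f : β → α} (hf : Primrec f)
    {g : β × ℕ → ℕ} (hg : Primrec g) :
    PiZeroOne (fun b x => p (f b) (fun n => x (g (b, n)))) := by
  obtain ⟨L, Q, hL, hQ, H⟩ := hp
  refine ⟨fun q => (L (f q.1, q.2)).map (fun m => g (q.1, m)),
    fun q => Q ((f q.1.1, q.1.2), q.2), by fun_prop,
    hQ.comp (f := fun q : (β × ℕ) × List ℕ => ((f q.1.1, q.1.2), q.2)) (by fun_prop), ?_⟩
  intro b x
  simp [H, Function.comp_def]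

theorem imp {p : α → Baire → Prop} (hp : PiZeroOne p) {L : α → List ℕ}
    {R : α × List ℕ → Prop} (hL : Primrec L) (hR : PrimrecPred R) :
    PiZeroOne (fun a x => R (a, (L a).map x) → p a x) := by
  obtain ⟨L', Q, hL', hQ, H⟩ := hp
  refine ⟨fun q => L q.1 ++ L' q,
    fun q => ¬ R (q.1.1, q.2.take (L q.1.1).length) ∨ Q (q.1, q.2.drop (L q.1.1).length),
    by fun_prop, ?_, ?_⟩
  · exact (hR.comp (f := fun q : (α × ℕ) × List ℕ => (q.1.1, q.2.take (L q.1.1).length))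
      (by fun_prop)).not.or
      (hQ.comp (f := fun q : (α × ℕ) × List ℕ => (q.1, q.2.drop (L q.1.1).length)) (by fun_prop))
  · intro a x
    have h1 : ∀ n, ((L a ++ L' (a, n)).map x).take (L a).length = (L a).map x := by
      intro n; rw [List.map_append, List.take_left' (by simp)]
    have h2 : ∀ n, ((L a ++ L' (a, n)).map x).drop (L a).length = (L' (a, n)).map x := by
      intro n; rw [List.map_append, List.drop_left' (by simp)]
    simp only [h1, h2, H]
    by_cases hR' : R (a, (L a).map x) <;> simp [hR']

theorem and {p q : α → Baire → Prop} (hp : PiZeroOne p) (hq : PiZeroOne q) :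
    PiZeroOne (fun a x => p a x ∧ q a x) := by
  obtain ⟨L, P, hL, hP, Hp⟩ := hp
  obtain ⟨M, Q, hM, hQ, Hq⟩ := hq
  refine ⟨fun r => L r ++ M r,
    fun r => P (r.1, r.2.take (L r.1).length) ∧ Q (r.1, r.2.drop (L r.1).length),
    by fun_prop, ?_, ?_⟩
  · exact (hP.comp (f := fun r : (α × ℕ) × List ℕ => (r.1, r.2.take (L r.1).length))
      (by fun_prop)).and
      (hQ.comp (f := fun r : (α × ℕ) × List ℕ => (r.1, r.2.drop (L r.1).length)) (by fun_prop))
  · intro a x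
    have h1 : ∀ n, ((L (a, n) ++ M (a, n)).map x).take (L (a, n)).length = (L (a, n)).map x := by
      intro n; rw [List.map_append, List.take_left' (by simp)]
    have h2 : ∀ n, ((L (a, n) ++ M (a, n)).map x).drop (L (a, n)).length = (M (a, n)).map x := by
      intro n; rw [List.map_append, List.drop_left' (by simp)]
    simp only [h1, h2, Hp, Hq, forall_and]

theorem forall_nat {p : α → ℕ → Baire → Prop}
    (hp : PiZeroOne (fun (q : α × ℕ) x => p q.1 q.2 x)) :
    PiZeroOne (fun a x => ∀ k, p a k x) := by
  obtain ⟨L, Q, hL, hQ, H⟩ := hp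
  refine ⟨fun q => L ((q.1, q.2.unpair.1), q.2.unpair.2),
    fun q => Q (((q.1.1, q.1.2.unpair.1), q.1.2.unpair.2), q.2), by fun_prop,
    hQ.comp (f := fun q : (α × ℕ) × List ℕ => (((q.1.1, q.1.2.unpair.1), q.1.2.unpair.2), q.2))
      (by fun_prop), ?_⟩
  intro a x
  have H' : ∀ k, p a k x ↔ ∀ n, Q (((a, k), n), (L ((a, k), n)).map x) := fun k => H (a, k) x
  simp only [H']
  constructor
  · intro h n; exact h _ _
  · intro h k n
    simpa using h (Nat.pair k n)

end PiZeroOne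

/-! ### The classes `Σ¹₁` and `Δ¹₁` of relations between numbers and reals -/

/-- Lightface `Σ¹₁` relations between numbers and reals. -/
def SigmaOneOne (p : α → Baire → Prop) : Prop :=
  ∃ q : α → Baire → Prop, PiZeroOne q ∧ ∀ a x, p a x ↔ ∃ y, q a (joinReal x y)

namespace SigmaOneOne

theorem of_iff {p q : α → Baire → Prop} (hp : SigmaOneOne p) (h : ∀ a x, q a x ↔ p a x) :
    SigmaOneOne q := by
  obtain ⟨P, hP, H⟩ := hp
  exact ⟨P, hP, fun a x => (h a x).trans (H a x)⟩

theorem of_piZeroOne {p : α → Baire → Prop} (hp : PiZeroOne p) : SigmaOneOne p :=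
  ⟨_, hp.subst (f := fun a => a) (by fun_prop) (g := fun q => 2 * q.2) (by fun_prop), by simp⟩

theorem subst {p : α → Baire → Prop} (hp : SigmaOneOne p) {f : β → α} (hf : Primrec f)
    {g : β × ℕ → ℕ} (hg : Primrec g) :
    SigmaOneOne (fun b x => p (f b) (fun n => x (g (b, n)))) := by
  obtain ⟨P, hP, H⟩ := hp
  refine ⟨_, hP.subst hf
    (g := fun q => if q.2 % 2 = 0 then 2 * g (q.1, q.2 / 2) else 2 * (q.2 / 2) + 1)
    (by fun_prop), ?_⟩
  intro b x
  simp only [H]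
  refine exists_congr fun y => ?_
  rw [← joinReal_comp x y (fun n => g (b, n)) (fun n => n)]

/-- A quantified real is addressed as the odd half of the real argument, the old argument as its
even half. -/
theorem exists_real {p : α → Baire → Baire → Prop}
    (hp : SigmaOneOne (fun a w => p a (leftHalf w) (rightHalf w))) :
    SigmaOneOne (fun a x => ∃ z, p a x z) := by
  obtain ⟨P, hP, H⟩ := hp
  refine ⟨_, hP.subst (f := fun a => a) (by fun_prop)
    (g := fun q => if q.2 % 2 = 0 then
      (if q.2 / 2 % 2 = 0 then 2 * (q.2 / 2 / 2) else 2 * (2 * (q.2 / 2 / 2)) + 1)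
        else 2 * (2 * (q.2 / 2) + 1) + 1) (by fun_prop), ?_⟩
  intro a x
  have H' : ∀ z, p a x z ↔ ∃ y, P a (joinReal (joinReal x z) y) := by
    intro z; simpa using H a (joinReal x z)
  simp only [H', joinReal_joinReal]
  constructor
  · rintro ⟨z, y, h⟩; exact ⟨joinReal z y, h⟩
  · rintro ⟨w, h⟩
    refine ⟨leftHalf w, rightHalf w, ?_⟩
    have : joinReal (leftHalf w) (rightHalf w) = w := by
      funext n
      by_cases hn : n % 2 = 0
      · simp only [joinReal, leftHalf, hn, if_true]; congr 1; omega
      · simp only [joinReal, rightHalf, hn, if_false]; congr 1; omega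
    rwa [this]

theorem forall_nat {p : α → ℕ → Baire → Prop}
    (hp : SigmaOneOne (fun (q : α × ℕ) x => p q.1 q.2 x)) :
    SigmaOneOne (fun a x => ∀ k, p a k x) := by
  obtain ⟨P, hP, H⟩ := hp
  have H' : ∀ a k x, p a k x ↔ ∃ y, P (a, k) (joinReal x y) := fun a k x => H (a, k) x
  refine ⟨_, PiZeroOne.forall_nat (p := fun a k w => P (a, k) (fun n => w
      (if n % 2 = 0 then 2 * (n / 2) else 2 * Nat.pair k (n / 2) + 1)))
    (hP.subst (f := fun q : α × ℕ => q) (by fun_prop) (g := fun q =>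
      if q.2 % 2 = 0 then 2 * (q.2 / 2) else 2 * Nat.pair q.1.2 (q.2 / 2) + 1) (by fun_prop)), ?_⟩
  intro a x
  simp only [H']
  have key : ∀ (y : Baire) k,
      (fun n => joinReal x y (if n % 2 = 0 then 2 * (n / 2) else 2 * Nat.pair k (n / 2) + 1)) =
        joinReal x (fun n => y (Nat.pair k n)) := fun y k =>
    (joinReal_comp x y (fun n => n) (fun n => Nat.pair k n)).symm
  simp only [key]
  constructor
  · intro h
    choose y hy using h
    exact ⟨fun m => y m.unpair.1 m.unpair.2, fun k => by simpa using hy k⟩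
  · rintro ⟨y, h⟩ k
    exact ⟨_, h k⟩

theorem exists_nat {p : α → ℕ → Baire → Prop}
    (hp : SigmaOneOne (fun (q : α × ℕ) x => p q.1 q.2 x)) :
    SigmaOneOne (fun a x => ∃ k, p a k x) := by
  obtain ⟨P, hP, H⟩ := hp
  have H' : ∀ a k x, p a k x ↔ ∃ y, P (a, k) (joinReal x y) := fun a k x => H (a, k) x
  -- The witness real carries `k` as its first value.
  refine ⟨_, PiZeroOne.forall_nat (p := fun a k w => ([1].map w = [k]) → P (a, k) (fun n => w
      (if n % 2 = 0 then 2 * (n / 2) else 2 * (n / 2 + 1) + 1)))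
    (PiZeroOne.imp (L := fun _ => [1]) (R := fun q : (α × ℕ) × List ℕ => q.2 = [q.1.2])
      (hP.subst (f := fun q : α × ℕ => q) (by fun_prop) (g := fun q =>
      if q.2 % 2 = 0 then 2 * (q.2 / 2) else 2 * (q.2 / 2 + 1) + 1) (by fun_prop))
      (by fun_prop) (primrecPred_eq (by fun_prop) (by fun_prop))), ?_⟩
  intro a x
  simp only [H']
  have key : ∀ (y : Baire),
      (fun n => joinReal x y (if n % 2 = 0 then 2 * (n / 2) else 2 * (n / 2 + 1) + 1)) =
        joinReal x (fun n => y (n + 1)) := fun y =>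
    (joinReal_comp x y (fun n => n) (fun n => n + 1)).symm
  have key' : ∀ y : Baire, joinReal x y 1 = y 0 := fun y => joinReal_two_mul_add_one x y 0
  simp only [key, List.map_cons, List.map_nil, key', List.cons.injEq, and_true]
  constructor
  · rintro ⟨k, y, h⟩
    refine ⟨fun n => Nat.casesOn n k y, fun k' hk' => ?_⟩
    obtain rfl : k = k' := hk'
    exact h
  · rintro ⟨y, h⟩
    exact ⟨y 0, _, h _ rfl⟩

theorem and {p q : α → Baire → Prop} (hp : SigmaOneOne p) (hq : SigmaOneOne q) :
    SigmaOneOne (fun a x => p a x ∧ q a x) := by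
  obtain ⟨P, hP, Hp⟩ := hp
  obtain ⟨Q, hQ, Hq⟩ := hq
  refine ⟨_, (hP.subst (f := fun a => a) (by fun_prop) (g := fun q =>
      if q.2 % 2 = 0 then 2 * (q.2 / 2) else 2 * (2 * (q.2 / 2)) + 1) (by fun_prop)).and
    (hQ.subst (f := fun a => a) (by fun_prop) (g := fun q =>
      if q.2 % 2 = 0 then 2 * (q.2 / 2) else 2 * (2 * (q.2 / 2) + 1) + 1) (by fun_prop)), ?_⟩
  intro a x
  have k1 : ∀ y : Baire,
      (fun n => joinReal x y (if n % 2 = 0 then 2 * (n / 2) else 2 * (2 * (n / 2)) + 1)) =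
        joinReal x (leftHalf y) := fun y =>
    (joinReal_comp x y (fun n => n) (fun n => 2 * n)).symm
  have k2 : ∀ y : Baire,
      (fun n => joinReal x y (if n % 2 = 0 then 2 * (n / 2) else 2 * (2 * (n / 2) + 1) + 1)) =
        joinReal x (rightHalf y) := fun y =>
    (joinReal_comp x y (fun n => n) (fun n => 2 * n + 1)).symm
  simp only [Hp, Hq, k1, k2]
  constructor
  · rintro ⟨⟨y, hy⟩, ⟨z, hz⟩⟩
    exact ⟨joinReal y z, by simpa using hy, by simpa using hz⟩
  · rintro ⟨w, hy, hz⟩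
    exact ⟨⟨_, hy⟩, ⟨_, hz⟩⟩

theorem imp {p : α → Baire → Prop} (hp : SigmaOneOne p) {C : α → Prop} (hC : PrimrecPred C) :
    SigmaOneOne (fun a x => C a → p a x) := by
  obtain ⟨P, hP, H⟩ := hp
  refine ⟨_, hP.imp (L := fun _ => []) (R := fun q => C q.1) (by fun_prop)
    (hC.comp (f := fun q : α × List ℕ => q.1) (by fun_prop)), ?_⟩
  intro a x
  by_cases h : C a
  · simp [h, H]
  · simp [h]

theorem or {p q : α → Baire → Prop} (hp : SigmaOneOne p) (hq : SigmaOneOne q) :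
    SigmaOneOne (fun a x => p a x ∨ q a x) := by
  have hp' : SigmaOneOne (fun (r : α × ℕ) x => p r.1 x) :=
    hp.subst (f := fun r : α × ℕ => r.1) (by fun_prop) (g := fun r => r.2) (by fun_prop)
  have hq' : SigmaOneOne (fun (r : α × ℕ) x => q r.1 x) :=
    hq.subst (f := fun r : α × ℕ => r.1) (by fun_prop) (g := fun r => r.2) (by fun_prop)
  have h0 : PrimrecPred (fun r : α × ℕ => r.2 = 0) := primrecPred_eq (by fun_prop) (by fun_prop)
  refine (exists_nat (p := fun a k x => (k = 0 → p a x) ∧ (¬ k = 0 → q a x))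
    ((hp'.imp h0).and (hq'.imp h0.not))).of_iff ?_
  intro a x
  constructor
  · rintro (h | h)
    · exact ⟨0, by simp [h]⟩
    · exact ⟨1, by simp [h]⟩
  · rintro ⟨k, h, h'⟩
    by_cases hk : k = 0
    · exact Or.inl (h hk)
    · exact Or.inr (h' hk)

end SigmaOneOne

/-- Lightface `Δ¹₁` relations between numbers and reals. -/
def DeltaOneOne (p : α → Baire → Prop) : Prop :=
  SigmaOneOne p ∧ SigmaOneOne (fun a x => ¬ p a x)

namespace DeltaOneOne

theorem of_iff {p q : α → Baire → Prop} (hp : DeltaOneOne p) (h : ∀ a x, q a x ↔ p a x) :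
    DeltaOneOne q :=
  ⟨hp.1.of_iff h, hp.2.of_iff fun a x => not_congr (h a x)⟩

theorem subst {p : α → Baire → Prop} (hp : DeltaOneOne p) {f : β → α} (hf : Primrec f)
    {g : β × ℕ → ℕ} (hg : Primrec g) :
    DeltaOneOne (fun b x => p (f b) (fun n => x (g (b, n)))) :=
  ⟨hp.1.subst hf hg, hp.2.subst hf hg⟩

theorem not {p : α → Baire → Prop} (hp : DeltaOneOne p) : DeltaOneOne (fun a x => ¬ p a x) :=
  ⟨hp.2, hp.1.of_iff fun _ _ => not_not⟩

theorem and {p q : α → Baire → Prop} (hp : DeltaOneOne p) (hq : DeltaOneOne q) :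
    DeltaOneOne (fun a x => p a x ∧ q a x) :=
  ⟨hp.1.and hq.1, (hp.2.or hq.2).of_iff fun _ _ => not_and_or⟩

theorem or {p q : α → Baire → Prop} (hp : DeltaOneOne p) (hq : DeltaOneOne q) :
    DeltaOneOne (fun a x => p a x ∨ q a x) :=
  ⟨hp.1.or hq.1, (hp.2.and hq.2).of_iff fun _ _ => not_or⟩

theorem imp {p q : α → Baire → Prop} (hp : DeltaOneOne p) (hq : DeltaOneOne q) :
    DeltaOneOne (fun a x => p a x → q a x) :=
  (hp.not.or hq).of_iff fun _ _ => imp_iff_not_or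

theorem iff {p q : α → Baire → Prop} (hp : DeltaOneOne p) (hq : DeltaOneOne q) :
    DeltaOneOne (fun a x => p a x ↔ q a x) :=
  ((hp.imp hq).and (hq.imp hp)).of_iff fun _ _ => iff_iff_implies_and_implies

theorem forall_nat {p : α → ℕ → Baire → Prop}
    (hp : DeltaOneOne (fun (q : α × ℕ) x => p q.1 q.2 x)) :
    DeltaOneOne (fun a x => ∀ k, p a k x) :=
  ⟨.forall_nat hp.1, (SigmaOneOne.exists_nat (p := fun a k x => ¬ p a k x) hp.2).of_iff
    fun _ _ => not_forall⟩

theorem exists_nat {p : α → ℕ → Baire → Prop}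
    (hp : DeltaOneOne (fun (q : α × ℕ) x => p q.1 q.2 x)) :
    DeltaOneOne (fun a x => ∃ k, p a k x) :=
  ⟨.exists_nat hp.1, (SigmaOneOne.forall_nat (p := fun a k x => ¬ p a k x) hp.2).of_iff
    fun _ _ => not_exists⟩

theorem forall_primcodable {δ : Type} [Primcodable δ] [Inhabited δ] {p : α → δ → Baire → Prop}
    (hp : DeltaOneOne (fun (q : α × δ) x => p q.1 q.2 x)) :
    DeltaOneOne (fun a x => ∀ d, p a d x) := by
  refine (forall_nat (p := fun a k x => p a ((decode (α := δ) k).getD default) x)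
    (hp.subst (f := fun q : α × ℕ => (q.1, (decode (α := δ) q.2).getD default)) (by fun_prop)
      (g := fun q => q.2) (by fun_prop))).of_iff fun a x => ?_
  exact ⟨fun h k => h _, fun h d => by simpa using h (encode d)⟩

theorem exists_primcodable {δ : Type} [Primcodable δ] [Inhabited δ] {p : α → δ → Baire → Prop}
    (hp : DeltaOneOne (fun (q : α × δ) x => p q.1 q.2 x)) :
    DeltaOneOne (fun a x => ∃ d, p a d x) :=
  (forall_primcodable (p := fun a d x => ¬ p a d x) hp.not).not.of_iff fun _ _ => by simp

theorem atom {L : α → List ℕ} {R : α × List ℕ → Prop} (hL : Primrec L) (hR : PrimrecPred R) :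
    DeltaOneOne (fun a x => R (a, (L a).map x)) :=
  ⟨.of_piZeroOne (.atom hL hR), .of_piZeroOne (.atom hL hR.not)⟩

theorem of_primrecPred {C : α → Prop} (hC : PrimrecPred C) :
    DeltaOneOne (fun a (_ : Baire) => C a) :=
  atom (L := fun _ => []) (R := fun q => C q.1) (by fun_prop)
    (hC.comp (f := fun q : α × List ℕ => q.1) (by fun_prop))

theorem eq {f g : α → ℕ} (hf : Primrec f) (hg : Primrec g) :
    DeltaOneOne (fun a (_ : Baire) => f a = g a) :=
  of_primrecPred (primrecPred_eq hf hg)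

/-- A recursively enumerable condition on numbers is `Σ⁰₁`, by bounded evaluation of a code. -/
theorem of_rePred {C : α → Prop} (hC : REPred C) : DeltaOneOne (fun a (_ : Baire) => C a) := by
  obtain ⟨c, hc⟩ := Nat.Partrec.Code.exists_code.1 hC
  have hev : Primrec (fun q : α × ℕ => Nat.Partrec.Code.evaln q.2 c (encode q.1)) :=
    Nat.Partrec.Code.primrec_evaln.comp (f := fun a : (ℕ × Nat.Partrec.Code) × ℕ =>
      Nat.Partrec.Code.evaln a.1.1 a.1.2 a.2)
      (g := fun q : α × ℕ => ((q.2, c), encode q.1)) (by fun_prop)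
  refine (exists_nat (p := fun a k _ => (Nat.Partrec.Code.evaln k c (encode a)).isSome = true)
    (of_primrecPred (primrecPred_eq (Primrec.option_isSome.comp hev) (by fun_prop)))).of_iff ?_
  intro a x
  have h1 : C a ↔ ∃ m, m ∈ Nat.Partrec.Code.eval c (encode a) := by
    rw [hc]
    simp
  rw [h1]
  simp only [Nat.Partrec.Code.evaln_complete, Option.isSome_iff_exists, Option.mem_def]
  exact exists_comm

end DeltaOneOne

end Classes

/-! ### Tree representations of `Σ¹₁` sets -/

/-- The first `n` values of a real. -/
def restrict (x : Baire) (n : ℕ) : List ℕ := (List.range n).map x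

@[simp] theorem length_restrict (x : Baire) (n : ℕ) : (restrict x n).length = n := by
  simp [restrict]

theorem restrict_getD {x : Baire} {n i : ℕ} (h : i < n) : (restrict x n).getD i 0 = x i := by
  simp [restrict, List.getD, h]

theorem restrict_succ (x : Baire) (n : ℕ) : restrict x (n + 1) = restrict x n ++ [x n] := by
  simp [restrict, List.range_succ]

theorem take_restrict {x : Baire} {m n : ℕ} (h : m ≤ n) :
    (restrict x n).take m = restrict x m := by
  simp [restrict, ← List.map_take, List.take_range, h]

theorem isInitial_iff (s : List ℕ) (x : Baire) : IsInitial s x ↔ restrict x s.length = s := by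
  unfold IsInitial restrict
  rw [List.ofFn_eq_map, ← List.map_coe_finRange_eq_range, List.map_map]
  rfl

/-- A `Σ¹₁` set is the projection of the set of branches of a primitive recursive tree of pairs of
finite sequences. -/
theorem SigmaOneOne.exists_tree {p : Baire → Prop} (hp : SigmaOneOne (fun (_ : Unit) x => p x)) :
    ∃ C : List ℕ × List ℕ → Prop, PrimrecPred C ∧ C ([], []) ∧
      ∀ x, p x ↔ ∃ y, ∀ n, C (restrict x n, restrict y n) := by
  obtain ⟨q, ⟨L, Q, hL, hQ, Hq⟩, H⟩ := hp
  -- `C (s, t)` checks those conditions with index below `|t|` whose queries are answered by `s, t`.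
  let val : (List ℕ × List ℕ) → ℕ → ℕ := fun st l =>
    if l % 2 = 0 then st.1.getD (l / 2) 0 else st.2.getD (l / 2) 0
  have hval : Primrec (fun r : (List ℕ × List ℕ) × ℕ => val r.1 r.2) := by
    simp only [val]; fun_prop
  let C : List ℕ × List ℕ → Prop := fun st => ∀ n < st.2.length,
    ¬ (∀ l ∈ L ((), n), l < st.2.length) ∨ Q (((), n), (L ((), n)).map (val st))
  have hC : PrimrecPred C := by
    have h1 : PrimrecRel (fun (l n : ℕ) => l < n) := Primrec.nat_lt
    have h2 : PrimrecPred (fun r : ℕ × (List ℕ × List ℕ) =>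
        ∀ l ∈ L ((), r.1), l < r.2.2.length) :=
      h1.forall_mem_list.comp (f := fun r : ℕ × (List ℕ × List ℕ) => L ((), r.1))
        (g := fun r => r.2.2.length) (by fun_prop) (by fun_prop)
    have h3 : PrimrecPred (fun r : ℕ × (List ℕ × List ℕ) =>
        Q (((), r.1), (L ((), r.1)).map (val r.2))) :=
      hQ.comp (f := fun r : ℕ × (List ℕ × List ℕ) => (((), r.1), (L ((), r.1)).map (val r.2)))
        (primrec_pair' (by fun_prop) (primrec_map' (by fun_prop)
          (hval.comp (g := fun p : (ℕ × (List ℕ × List ℕ)) × ℕ => (p.1.2, p.2)) (by fun_prop))))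
    have h4 : PrimrecRel (fun (n : ℕ) (st : List ℕ × List ℕ) =>
        ¬ (∀ l ∈ L ((), n), l < st.2.length) ∨ Q (((), n), (L ((), n)).map (val st))) :=
      h2.not.or h3
    exact (h4.forall_mem_list.comp (f := fun st : List ℕ × List ℕ => List.range st.2.length)
      (g := fun st => st) (by fun_prop) (by fun_prop)).of_eq fun st => by simp [C]
  refine ⟨C, hC, by simp [C], fun x => ?_⟩
  refine (H () x).trans ?_
  refine exists_congr fun y => ?_
  rw [Hq]
  have hmap : ∀ n N, (∀ l ∈ L ((), n), l < N) →
      (L ((), n)).map (val (restrict x N, restrict y N)) = (L ((), n)).map (joinReal x y) := by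
    intro n N h
    refine List.map_congr_left fun l hl => ?_
    have : l / 2 < N := lt_of_le_of_lt (Nat.div_le_self _ _) (h l hl)
    simp only [val, joinReal, restrict_getD this]
  constructor
  · intro h N n _
    by_cases hb : ∀ l ∈ L ((), n), l < (restrict y N).length
    · right
      simp only [length_restrict] at hb
      simpa only [hmap n N hb] using h n
    · exact Or.inl hb
  · intro h n
    have hb : ∀ l ∈ L ((), n), l < max (n + 1) ((L ((), n)).sum + 1) := fun l hl =>
      lt_of_lt_of_le (Nat.lt_succ_of_le (List.le_sum_of_mem hl)) (le_max_right _ _)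
    rcases h (max (n + 1) ((L ((), n)).sum + 1)) n (by simp) with h' | h'
    · exact absurd (by simpa using hb) h'
    · simpa only [hmap n _ hb] using h'

theorem deltaOneOne_isInitial :
    DeltaOneOne (fun (s : List ℕ) x => IsInitial s x) :=
  (DeltaOneOne.atom (L := fun s : List ℕ => List.range s.length) (R := fun q => q.2 = q.1)
    (by fun_prop) (primrecPred_eq (by fun_prop) (by fun_prop))).of_iff isInitial_iff

theorem IsSigma11.sigmaOneOne {A : Set Baire} (hA : IsSigma11 A) :
    SigmaOneOne (fun (_ : Unit) x => x ∈ A) := by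
  obtain ⟨P, ⟨W, hW, hP⟩, rfl⟩ := hA
  refine SigmaOneOne.exists_real (p := fun (_ : Unit) x y => (x, y) ∈ P) ?_
  have key : DeltaOneOne (fun (_ : Unit) w => ∃ s t : List ℕ,
      W (s, t) ∧ IsInitial s (leftHalf w) ∧ IsInitial t (rightHalf w)) :=
    .exists_primcodable <| .exists_primcodable <|
      ((DeltaOneOne.of_rePred hW).subst (f := fun q : (Unit × List ℕ) × List ℕ => (q.1.2, q.2))
        (by fun_prop) (g := fun q => q.2) (by fun_prop)).and <|
      (deltaOneOne_isInitial.subst (f := fun q : (Unit × List ℕ) × List ℕ => q.1.2)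
        (by fun_prop) (g := fun q => 2 * q.2) (by fun_prop)).and
      (deltaOneOne_isInitial.subst (f := fun q : (Unit × List ℕ) × List ℕ => q.2)
        (by fun_prop) (g := fun q => 2 * q.2 + 1) (by fun_prop))
  refine key.2.of_iff fun _ w => ?_
  have := Set.ext_iff.1 hP (leftHalf w, rightHalf w)
  simp only [Set.mem_compl_iff, Set.mem_ofPred_eq] at this
  exact not_not.symm.trans (not_congr this)

theorem SigmaOneOne.isSigma11 {A : Set Baire} (hA : SigmaOneOne (fun (_ : Unit) x => x ∈ A)) :
    IsSigma11 A := by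
  obtain ⟨C, hC, -, H⟩ := hA.exists_tree
  refine ⟨{q | ∀ n, C (restrict q.1 n, restrict q.2 n)},
    ⟨fun st => st.1.length = st.2.length ∧ ¬ C st, ?_, ?_⟩, Set.ext H⟩
  · exact ((primrecPred_eq (by fun_prop) (by fun_prop)).and hC.not).computablePred.to_re
  · ext ⟨x, y⟩
    simp only [Set.mem_compl_iff, Set.mem_ofPred_eq, isInitial_iff, not_forall]
    constructor
    · rintro ⟨n, hn⟩
      exact ⟨restrict x n, restrict y n, by simpa using hn, by simp, by simp⟩
    · rintro ⟨s, t, ⟨hl, hC⟩, hs, ht⟩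
      refine ⟨s.length, ?_⟩
      rw [hs, hl, ht]
      exact hC

/-! ### Comparison of trees -/

/-- `v` is an immediate successor of `u` that belongs to `T`. Finite sequences are written with the
last entry first, so that the successors of `u` are the `i :: u`. -/
def IsChild (T : List ℕ → Prop) (v u : List ℕ) : Prop := T v ∧ ∃ i, v = i :: u

/-- The initial segment of length `n` of a real, last entry first. -/
def branch (y : Baire) (n : ℕ) : List ℕ := (restrict y n).reverse

theorem branch_succ (y : Baire) (n : ℕ) : branch y (n + 1) = y n :: branch y n := by
  simp [branch, restrict_succ]

/-- `f` maps the tree `S` into the tree `T`, immediate successors to immediate successors. -/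
def IsTreeHom (S T : List ℕ → Prop) (f : List ℕ → List ℕ) : Prop :=
  (∀ u, S u → T (f u)) ∧ ∀ u i, S (i :: u) → ∃ j, f (i :: u) = j :: f u

theorem IsTreeHom.isChild {S T : List ℕ → Prop} {f : List ℕ → List ℕ} (hf : IsTreeHom S T f)
    {v u : List ℕ} (h : IsChild S v u) : IsChild T (f v) (f u) := by
  obtain ⟨hv, i, rfl⟩ := h
  exact ⟨hf.1 _ hv, hf.2 u i hv⟩

theorem IsTreeHom.wellFounded {S T : List ℕ → Prop} {f : List ℕ → List ℕ} (hf : IsTreeHom S T f)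
    (hT : WellFounded (IsChild T)) : WellFounded (IsChild S) :=
  Subrelation.wf (fun h => hf.isChild h) (InvImage.wf f hT)

theorem not_wellFounded_of_branch {T : List ℕ → Prop} {y : Baire} (h : ∀ n, T (branch y n)) :
    ¬ WellFounded (IsChild T) := fun hwf =>
  (wellFounded_iff_isEmpty_descending_chain.1 hwf).elim
    ⟨branch y, fun n => ⟨h (n + 1), y n, branch_succ y n⟩⟩

theorem exists_branch_of_not_wellFounded {T : List ℕ → Prop} (hT : ∀ i u, T (i :: u) → T u)
    (h : ¬ WellFounded (IsChild T)) : ∃ y, ∀ n, T (branch y n) := by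
  rw [wellFounded_iff_isEmpty_descending_chain, not_isEmpty_iff] at h
  obtain ⟨c, hc⟩ := h
  have hTc : ∀ n, T (c n) := fun n => by
    obtain ⟨i, hi⟩ := (hc n).2
    exact hT i _ (hi ▸ (hc n).1)
  choose e he using fun n => (hc n).2
  -- The chain starts at `c 0`; the branch runs through `c 0` and then along the chain.
  let y : Baire := fun k => if k < (c 0).length then (c 0).reverse.getD k 0
    else e (k - (c 0).length)
  have hdown : ∀ u v, T (u ++ v) → T v := by
    intro u
    induction u with
    | nil => exact fun v h => h
    | cons a u ih => exact fun v h => ih v (hT _ _ h)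
  have h0 : branch y (c 0).length = c 0 := by
    rw [branch, List.reverse_eq_iff]
    apply List.ext_getElem (by simp)
    intro i h1 h2
    have hi : i < (c 0).length := by simpa using h1
    simp [restrict, y, hi, List.getD]
  have h1 : ∀ n, branch y ((c 0).length + n) = c n := by
    intro n
    induction n with
    | zero => exact h0
    | succ n ih =>
      rw [← add_assoc, branch_succ, ih, he n]
      simp [y]
  have h2 : ∀ m n, ∃ u, branch y (n + m) = u ++ branch y n := by
    intro m n
    induction m with
    | zero => exact ⟨[], rfl⟩
    | succ m ih =>
      obtain ⟨u, hu⟩ := ih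
      exact ⟨y (n + m) :: u, by rw [← add_assoc, branch_succ, hu]; rfl⟩
  refine ⟨y, fun n => ?_⟩
  obtain ⟨u, hu⟩ := h2 (c 0).length n
  refine hdown u _ ?_
  rw [← hu, add_comm, h1]
  exact hTc n

open IsWellFounded (rank)

/-- A map along which ranks do not drop, built by recursion on the length of sequences. -/
theorem exists_isTreeHom_of_rank_le {S T : List ℕ → Prop} (hSc : ∀ i u, S (i :: u) → S u)
    [IsWellFounded _ (IsChild S)] [IsWellFounded _ (IsChild T)] {w : List ℕ} (hw : T w)
    (hr : rank (IsChild S) [] ≤ rank (IsChild T) w) :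
    ∃ f, IsTreeHom S T f ∧ f [] = w := by
  classical
  let next : List ℕ → List ℕ → List ℕ := fun v w =>
    if h : ∃ j, T (j :: w) ∧ rank (IsChild S) v ≤ rank (IsChild T) (j :: w)
    then h.choose :: w else []
  let f : List ℕ → List ℕ := fun u => List.rec w (fun i u fu => next (i :: u) fu) u
  have hstep : ∀ i u, S (i :: u) → rank (IsChild S) u ≤ rank (IsChild T) (f u) →
      ∃ j, T (j :: f u) ∧ rank (IsChild S) (i :: u) ≤ rank (IsChild T) (j :: f u) := by
    intro i u hi hle
    have hlt : rank (IsChild S) (i :: u) < rank (IsChild T) (f u) :=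
      lt_of_lt_of_le (IsWellFounded.rank_lt_of_rel ⟨hi, i, rfl⟩) hle
    rw [IsWellFounded.rank_eq (IsChild T), Ordinal.lt_iSup_iff] at hlt
    obtain ⟨⟨v, hv, j, rfl⟩, hlt⟩ := hlt
    exact ⟨j, hv, Order.lt_succ_iff.1 hlt⟩
  have hfc : ∀ i u
      (h : ∃ j, T (j :: f u) ∧ rank (IsChild S) (i :: u) ≤ rank (IsChild T) (j :: f u)),
      f (i :: u) = h.choose :: f u := fun i u h => dif_pos h
  have hinv : ∀ u, S u → T (f u) ∧ rank (IsChild S) u ≤ rank (IsChild T) (f u) := by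
    intro u
    induction u with
    | nil => exact fun _ => ⟨hw, hr⟩
    | cons i u ih =>
      intro hi
      have h := hstep i u hi (ih (hSc i u hi)).2
      rw [hfc i u h]
      exact h.choose_spec
  exact ⟨f, ⟨fun u hu => (hinv u hu).1, fun u i hi =>
    ⟨_, hfc i u (hstep i u hi (hinv u (hSc i u hi)).2)⟩⟩, rfl⟩

/-- Of two trees that are not both ill-founded, either `S` maps to the part of `T` above some child
of the root, or `T` maps to `S` from root to root, and these cases exclude each other: they say that
the rank of `S` is below that of `T`, or is not, where an ill-founded tree has rank `∞`. -/
theorem exists_isTreeHom_nonroot_iff {S T : List ℕ → Prop} (hSc : ∀ i u, S (i :: u) → S u)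
    (hTc : ∀ i u, T (i :: u) → T u) (hS0 : S []) (hT0 : T [])
    (h : WellFounded (IsChild S) ∨ WellFounded (IsChild T)) :
    (∃ f, IsTreeHom S T f ∧ ∃ j, f [] = [j]) ↔ ¬ ∃ g, IsTreeHom T S g ∧ g [] = [] := by
  constructor
  · rintro ⟨f, hf, j, hj⟩ ⟨g, hg, hg0⟩
    have hT : WellFounded (IsChild T) := h.elim hg.wellFounded id
    -- Iterating `f ∘ g` from the root climbs forever.
    let c : ℕ → List ℕ := fun n => (f ∘ g)^[n] []
    have hc : ∀ n, Relation.TransGen (IsChild T) (c (n + 1)) (c n) := by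
      intro n
      induction n with
      | zero =>
        refine .single ⟨?_, j, ?_⟩
        · exact hf.1 _ (hg.1 _ hT0)
        · simp [c, hg0, hj]
      | succ n ih =>
        have := Relation.TransGen.lift (f ∘ g) (fun a b hab => hf.isChild (hg.isChild hab)) _ _ ih
        simpa only [c, Function.onFun, Function.iterate_succ', Function.comp_apply] using this
    exact (wellFounded_iff_isEmpty_descending_chain.1 hT.transGen).elim ⟨c, hc⟩
  · intro hng
    by_cases hT : WellFounded (IsChild T)
    · by_cases hS : WellFounded (IsChild S)
      · have : IsWellFounded _ (IsChild S) := ⟨hS⟩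
        have : IsWellFounded _ (IsChild T) := ⟨hT⟩
        have hlt : rank (IsChild S) [] < rank (IsChild T) [] := by
          by_contra hle
          exact hng (exists_isTreeHom_of_rank_le hTc hS0 (not_lt.1 hle))
        rw [IsWellFounded.rank_eq (IsChild T), Ordinal.lt_iSup_iff] at hlt
        obtain ⟨⟨v, hv, j, rfl⟩, hlt⟩ := hlt
        obtain ⟨f, hf, hf0⟩ := exists_isTreeHom_of_rank_le hSc hv (Order.lt_succ_iff.1 hlt)
        exact ⟨f, hf, j, hf0⟩
      · obtain ⟨y, hy⟩ := exists_branch_of_not_wellFounded hSc hS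
        exact absurd ⟨fun u => branch y u.length,
          ⟨fun u _ => hy _, fun u i _ => ⟨y u.length, branch_succ y _⟩⟩, rfl⟩ hng
    · obtain ⟨y, hy⟩ := exists_branch_of_not_wellFounded hTc hT
      exact ⟨fun u => branch y (u.length + 1),
        ⟨fun u _ => hy _, fun u i _ => ⟨y (u.length + 1), branch_succ y _⟩⟩, y 0, branch_succ y 0⟩

/-! ### Separation of `Σ¹₁` sets -/

/-- The real `F` codes a homomorphism from `S` to `T` whose value at the root satisfies `R`. -/
def CodesTreeHom (S T : List ℕ → Prop) (R : List ℕ → Prop) (F : Baire) : Prop :=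
  (∃ w, F (encode ([] : List ℕ)) = encode w ∧ R w) ∧
  (∀ u, S u → ∃ w, F (encode u) = encode w ∧ T w) ∧
  ∀ u i, S (i :: u) → ∃ (j : ℕ) (w : List ℕ), F (encode u) = encode w ∧
    F (encode (i :: u)) = encode (j :: w)

theorem exists_codesTreeHom_iff {S T R : List ℕ → Prop} :
    (∃ F, CodesTreeHom S T R F) ↔ ∃ f, IsTreeHom S T f ∧ R (f []) := by
  constructor
  · rintro ⟨F, ⟨w, hw, hR⟩, h1, h2⟩
    have key : ∀ {u w : List ℕ}, F (encode u) = encode w →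
        (decode (α := List ℕ) (F (encode u))).getD [] = w := by
      intro u w h; simp [h]
    refine ⟨fun u => (decode (α := List ℕ) (F (encode u))).getD [], ⟨fun u hu => ?_,
      fun u i hi => ?_⟩, ?_⟩
    · obtain ⟨w, hw, hT⟩ := h1 u hu
      simpa only [key hw] using hT
    · obtain ⟨j, w, hw, hjw⟩ := h2 u i hi
      exact ⟨j, by simp only [key hw, key hjw]⟩
    · simpa only [key hw] using hR
  · rintro ⟨f, hf, hR⟩
    refine ⟨fun n => encode (f ((decode (α := List ℕ) n).getD [])), ⟨f [], by simp, hR⟩,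
      fun u hu => ⟨f u, by simp, hf.1 u hu⟩, fun u i hi => ?_⟩
    obtain ⟨j, hj⟩ := hf.2 u i hi
    exact ⟨j, f u, by simp, by simp [hj]⟩

theorem deltaOneOne_apply_eq {α : Type} [Primcodable α] {f g : α → ℕ} (hf : Primrec f)
    (hg : Primrec g) : DeltaOneOne (fun a x => x (f a) = g a) :=
  (DeltaOneOne.atom (L := fun a => [f a]) (R := fun q => q.2 = [g q.1]) (by fun_prop)
    (primrecPred_eq (by fun_prop) (by fun_prop))).of_iff fun _ _ => by simp

theorem sigmaOneOne_exists_codesTreeHom {S T : Baire → List ℕ → Prop} {R : List ℕ → Prop}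
    (hS : DeltaOneOne (fun u x => S x u)) (hT : DeltaOneOne (fun u x => T x u))
    (hR : PrimrecPred R) :
    SigmaOneOne (fun (_ : Unit) x => ∃ F, CodesTreeHom (S x) (T x) R F) := by
  have key : DeltaOneOne (fun (_ : Unit) w =>
    CodesTreeHom (S (leftHalf w)) (T (leftHalf w)) R (rightHalf w)) := ?_
  · exact SigmaOneOne.exists_real (p := fun (_ : Unit) x F => CodesTreeHom (S x) (T x) R F) key.1
  refine .and ?_ (.and ?_ ?_)
  · exact .exists_primcodable <|
      (deltaOneOne_apply_eq (f := fun _ : Unit × List ℕ => 2 * encode ([] : List ℕ) + 1)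
        (g := fun q => encode q.2) (by fun_prop) (by fun_prop)).and
      (.of_primrecPred (hR.comp (f := fun q : Unit × List ℕ => q.2) (by fun_prop)))
  · exact .forall_primcodable <|
      (hS.subst (f := fun q : Unit × List ℕ => q.2) (by fun_prop) (g := fun q => 2 * q.2)
        (by fun_prop)).imp <| .exists_primcodable <|
      (deltaOneOne_apply_eq (f := fun q : (Unit × List ℕ) × List ℕ => 2 * encode q.1.2 + 1)
        (g := fun q => encode q.2) (by fun_prop) (by fun_prop)).and
      (hT.subst (f := fun q : (Unit × List ℕ) × List ℕ => q.2) (by fun_prop)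
        (g := fun q => 2 * q.2) (by fun_prop))
  · exact .forall_primcodable <| .forall_primcodable <|
      (hS.subst (f := fun q : (Unit × List ℕ) × ℕ => q.2 :: q.1.2) (by fun_prop)
        (g := fun q => 2 * q.2) (by fun_prop)).imp <|
      .exists_primcodable <| .exists_primcodable <|
      (deltaOneOne_apply_eq
        (f := fun q : (((Unit × List ℕ) × ℕ) × ℕ) × List ℕ => 2 * encode q.1.1.1.2 + 1)
        (g := fun q => encode q.2) (by fun_prop) (by fun_prop)).and
      (deltaOneOne_apply_eq
        (f := fun q : (((Unit × List ℕ) × ℕ) × ℕ) × List ℕ =>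
          2 * encode (q.1.1.2 :: q.1.1.1.2) + 1)
        (g := fun q => encode (q.1.2 :: q.2)) (by fun_prop) (by fun_prop))

/-- A `Σ¹₁` set in terms of `Δ¹₁` trees of finite sequences written with the last entry first. -/
theorem SigmaOneOne.exists_branch_tree {p : Baire → Prop}
    (hp : SigmaOneOne (fun (_ : Unit) x => p x)) :
    ∃ T : Baire → List ℕ → Prop, DeltaOneOne (fun u x => T x u) ∧ (∀ x, T x []) ∧
      (∀ x i u, T x (i :: u) → T x u) ∧ ∀ x, p x ↔ ∃ y, ∀ n, T x (branch y n) := by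
  obtain ⟨C, hC, h0, H⟩ := hp.exists_tree
  refine ⟨fun x u => ∀ m, m ≤ u.length → C (restrict x m, u.reverse.take m), ?_, ?_, ?_, ?_⟩
  · exact .forall_nat <| .imp
      (.of_primrecPred (primrecPred_le (f := fun q : List ℕ × ℕ => q.2) (by fun_prop)
        (by fun_prop)))
      (.atom (L := fun q : List ℕ × ℕ => List.range q.2)
        (R := fun r => C (r.2, r.1.1.reverse.take r.1.2)) (by fun_prop)
        (hC.comp (f := fun r : (List ℕ × ℕ) × List ℕ => (r.2, r.1.1.reverse.take r.1.2))
          (by fun_prop)))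
  · rintro x m hm
    obtain rfl : m = 0 := by simpa using hm
    simpa [restrict] using h0
  · intro x i u h m hm
    have := h m (by simp; omega)
    rwa [List.reverse_cons, List.take_append_of_le_length (by simpa using hm)] at this
  · intro x
    rw [H x]
    refine exists_congr fun y => ⟨fun h n m hm => ?_, fun h n => ?_⟩
    · have hm' : m ≤ n := by simpa [branch] using hm
      simpa [branch, take_restrict hm'] using h m
    · simpa [branch, take_restrict] using h n n (by simp [branch])

/-- Disjoint `Σ¹₁` sets are separated by a `Δ¹₁` set: compare the ranks of the trees that witness
membership, which are never both ill-founded. -/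
theorem SigmaOneOne.exists_separation {p q : Baire → Prop}
    (hp : SigmaOneOne (fun (_ : Unit) x => p x)) (hq : SigmaOneOne (fun (_ : Unit) x => q x))
    (hpq : ∀ x, p x → ¬ q x) :
    ∃ r : Baire → Prop, DeltaOneOne (fun (_ : Unit) x => r x) ∧ (∀ x, p x → r x) ∧
      ∀ x, q x → ¬ r x := by
  obtain ⟨T, hT, hT0, hTc, HT⟩ := hp.exists_branch_tree
  obtain ⟨S, hS, hS0, hSc, HS⟩ := hq.exists_branch_tree
  have hwf : ∀ x, WellFounded (IsChild (S x)) ∨ WellFounded (IsChild (T x)) := by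
    intro x
    by_contra hcon
    rw [not_or] at hcon
    exact hpq x ((HT x).2 (exists_branch_of_not_wellFounded (hTc x) hcon.2))
      ((HS x).2 (exists_branch_of_not_wellFounded (hSc x) hcon.1))
  have hroot : PrimrecPred (fun u : List ℕ => ¬ u = [] ∧ u.length ≤ 1) :=
    (primrecPred_eq (by fun_prop) (by fun_prop)).not.and
      (primrecPred_le (by fun_prop) (by fun_prop))
  have hroot' : ∀ u : List ℕ, (¬ u = [] ∧ u.length ≤ 1) ↔ ∃ j, u = [j] := by
    rintro (_ | ⟨i, _ | ⟨j, u⟩⟩) <;> simp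
  have hiff := fun x =>
    exists_isTreeHom_nonroot_iff (hSc x) (hTc x) (hS0 x) (hT0 x) (hwf x)
  refine ⟨fun x => ∃ f, IsTreeHom (S x) (T x) f ∧ ∃ j, f [] = [j], ⟨?_, ?_⟩, ?_, ?_⟩
  · refine (sigmaOneOne_exists_codesTreeHom hS hT hroot).of_iff fun _ x => ?_
    rw [exists_codesTreeHom_iff]
    simp only [hroot']
  · refine (sigmaOneOne_exists_codesTreeHom hT hS (R := fun u => u = [])
      (primrecPred_eq (by fun_prop) (by fun_prop))).of_iff fun _ x => ?_
    rw [exists_codesTreeHom_iff]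
    exact (not_congr (hiff x)).trans not_not
  · intro x hx
    rw [hiff]
    rintro ⟨g, hg, -⟩
    obtain ⟨y, hy⟩ := (HT x).1 hx
    have hnT := not_wellFounded_of_branch hy
    exact (hwf x).elim (fun h => hnT (hg.wellFounded h)) hnT
  · rintro x hx ⟨f, hf, -⟩
    obtain ⟨y, hy⟩ := (HS x).1 hx
    have hnS := not_wellFounded_of_branch hy
    exact (hwf x).elim hnS (fun h => hnS (hf.wellFounded h))

/-! ### Turing reducibility -/

/-- The `e`-th partial function recursive in `y`, for a numbering of the terms that generate the
functions recursive in `y`: `0, …, 4` are the basic functions, and `4 * ⟨a, b⟩ + 5 + j` for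
`j = 0, …, 3` is the pairing, composition or primitive recursion of the functions with numbers `a`
and `b`, or the unbounded search on the function with number `a`. -/
def oracleEval (y : Baire) : ℕ → ℕ → Part ℕ
  | 0 => fun _ => Part.some 0
  | 1 => fun n => Part.some (n + 1)
  | 2 => fun n => Part.some n.unpair.1
  | 3 => fun n => Part.some n.unpair.2
  | 4 => fun n => Part.some (y n)
  | e + 5 =>
    have h1 : (e / 4).unpair.1 < e + 5 :=
      lt_of_le_of_lt ((Nat.unpair_left_le _).trans (Nat.div_le_self _ _)) (by omega)
    have h2 : (e / 4).unpair.2 < e + 5 :=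
      lt_of_le_of_lt ((Nat.unpair_right_le _).trans (Nat.div_le_self _ _)) (by omega)
    let f := oracleEval y (e / 4).unpair.1
    let h := oracleEval y (e / 4).unpair.2
    if e % 4 = 0 then fun n => ((f n).map Nat.pair).bind fun g => (h n).map g
    else if e % 4 = 1 then fun n => (h n).bind f
    else if e % 4 = 2 then fun p => p.unpair.2.rec (f p.unpair.1) fun i IH =>
      IH.bind fun k => h (Nat.pair p.unpair.1 (Nat.pair i k))
    else fun n => Nat.rfind fun m => (f (Nat.pair n m)).map fun k => decide (k = 0)
termination_by e => e

theorem oracleEval_pair (y : Baire) (a b : ℕ) : oracleEval y (4 * Nat.pair a b + 5) =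
    fun n => ((oracleEval y a n).map Nat.pair).bind fun g => (oracleEval y b n).map g := by
  have h1 : 4 * Nat.pair a b % 4 = 0 := by omega
  have h2 : 4 * Nat.pair a b / 4 = Nat.pair a b := by omega
  rw [oracleEval]
  simp only [h1, h2, Nat.unpair_pair]
  rw [if_pos trivial]

theorem oracleEval_comp (y : Baire) (a b : ℕ) : oracleEval y (4 * Nat.pair a b + 6) =
    fun n => (oracleEval y b n).bind (oracleEval y a) := by
  have h1 : (4 * Nat.pair a b + 1) % 4 = 1 := by omega
  have h2 : (4 * Nat.pair a b + 1) / 4 = Nat.pair a b := by omega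
  rw [show 4 * Nat.pair a b + 6 = 4 * Nat.pair a b + 1 + 5 from rfl, oracleEval]
  simp only [h1, h2, Nat.unpair_pair]
  rw [if_neg (by decide), if_pos trivial]

theorem oracleEval_prec (y : Baire) (a b : ℕ) : oracleEval y (4 * Nat.pair a b + 7) =
    fun p => p.unpair.2.rec (oracleEval y a p.unpair.1) fun i IH =>
      IH.bind fun k => oracleEval y b (Nat.pair p.unpair.1 (Nat.pair i k)) := by
  have h1 : (4 * Nat.pair a b + 2) % 4 = 2 := by omega
  have h2 : (4 * Nat.pair a b + 2) / 4 = Nat.pair a b := by omega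
  rw [show 4 * Nat.pair a b + 7 = 4 * Nat.pair a b + 2 + 5 from rfl, oracleEval]
  simp only [h1, h2, Nat.unpair_pair]
  rw [if_neg (by decide), if_neg (by decide), if_pos trivial]

theorem oracleEval_rfind (y : Baire) (a b : ℕ) : oracleEval y (4 * Nat.pair a b + 8) =
    fun n => Nat.rfind fun m => (oracleEval y a (Nat.pair n m)).map fun k => decide (k = 0) := by
  have h1 : (4 * Nat.pair a b + 3) % 4 = 3 := by omega
  have h2 : (4 * Nat.pair a b + 3) / 4 = Nat.pair a b := by omega
  rw [show 4 * Nat.pair a b + 8 = 4 * Nat.pair a b + 3 + 5 from rfl, oracleEval]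
  simp only [h1, h2, Nat.unpair_pair]
  rw [if_neg (by decide), if_neg (by decide), if_neg (by decide)]

/-- Induction along the numbering of `oracleEval`. -/
@[elab_as_elim]
theorem oracle_index_induction {C : ℕ → Prop} (h : ∀ e < 5, C e)
    (h' : ∀ a b, C a → C b → C (4 * Nat.pair a b + 5) ∧ C (4 * Nat.pair a b + 6) ∧
      C (4 * Nat.pair a b + 7) ∧ C (4 * Nat.pair a b + 8)) (e : ℕ) : C e := by
  induction e using Nat.strong_induction_on with
  | _ e ih =>
    by_cases he : e < 5
    · exact h e he
    · obtain ⟨d, rfl⟩ : ∃ d, e = d + 5 := ⟨e - 5, by omega⟩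
      obtain ⟨h0, h1, h2, h3⟩ := h' (d / 4).unpair.1 (d / 4).unpair.2
        (ih _ (lt_of_le_of_lt ((Nat.unpair_left_le _).trans (Nat.div_le_self _ _)) (by omega)))
        (ih _ (lt_of_le_of_lt ((Nat.unpair_right_le _).trans (Nat.div_le_self _ _)) (by omega)))
      rw [Nat.pair_unpair] at h0 h1 h2 h3
      obtain hd | hd | hd | hd : d + 5 = 4 * (d / 4) + 5 ∨ d + 5 = 4 * (d / 4) + 6 ∨
        d + 5 = 4 * (d / 4) + 7 ∨ d + 5 = 4 * (d / 4) + 8 := by omega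
      all_goals rw [hd]; assumption

theorem recursiveIn_iff_exists_oracleEval (y : Baire) (f : ℕ →. ℕ) :
    Nat.RecursiveIn {fun n => Part.some (y n)} f ↔ ∃ e, oracleEval y e = f := by
  constructor
  · intro hf
    induction hf with
    | zero => exact ⟨0, by rw [oracleEval]; rfl⟩
    | succ => exact ⟨1, by rw [oracleEval]; rfl⟩
    | left => exact ⟨2, by rw [oracleEval]; rfl⟩
    | right => exact ⟨3, by rw [oracleEval]; rfl⟩
    | oracle g hg => obtain rfl := hg; exact ⟨4, by rw [oracleEval]⟩
    | pair _ _ ih1 ih2 =>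
      obtain ⟨⟨a, rfl⟩, ⟨b, rfl⟩⟩ := ih1, ih2
      exact ⟨_, oracleEval_pair y a b⟩
    | comp _ _ ih1 ih2 =>
      obtain ⟨⟨a, rfl⟩, ⟨b, rfl⟩⟩ := ih1, ih2
      exact ⟨_, oracleEval_comp y a b⟩
    | prec _ _ ih1 ih2 =>
      obtain ⟨⟨a, rfl⟩, ⟨b, rfl⟩⟩ := ih1, ih2
      exact ⟨_, oracleEval_prec y a b⟩
    | rfind _ ih =>
      obtain ⟨a, rfl⟩ := ih
      exact ⟨_, oracleEval_rfind y a 0⟩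
  · rintro ⟨e, rfl⟩
    induction e using oracle_index_induction with
    | h e he =>
      interval_cases e <;> rw [oracleEval]
      exacts [.zero, .succ, .left, .right, .oracle _ rfl]
    | h' a b ha hb =>
      rw [oracleEval_pair, oracleEval_comp, oracleEval_prec, oracleEval_rfind]
      exact ⟨.pair ha hb, .comp ha hb, .prec ha hb, .rfind ha⟩

/-- The recursive clauses for the graph `G e n m` of the functions `oracleEval y e`. They determine
`G` and use only quantifiers over numbers. -/
def IsOracleEvaluation (y : Baire) (G : ℕ → ℕ → ℕ → Prop) : Prop :=
  (∀ n m, G 0 n m ↔ m = 0) ∧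
  (∀ n m, G 1 n m ↔ m = n + 1) ∧
  (∀ n m, G 2 n m ↔ m = n.unpair.1) ∧
  (∀ n m, G 3 n m ↔ m = n.unpair.2) ∧
  (∀ n m, G 4 n m ↔ y n = m) ∧
  (∀ a b n m, G (4 * Nat.pair a b + 5) n m ↔ G a n m.unpair.1 ∧ G b n m.unpair.2) ∧
  (∀ a b n m, G (4 * Nat.pair a b + 6) n m ↔ ∃ k, G b n k ∧ G a k m) ∧
  (∀ a b n m, G (4 * Nat.pair a b + 7) (Nat.pair n 0) m ↔ G a n m) ∧
  (∀ a b n i m, G (4 * Nat.pair a b + 7) (Nat.pair n (i + 1)) m ↔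
    ∃ k, G (4 * Nat.pair a b + 7) (Nat.pair n i) k ∧ G b (Nat.pair n (Nat.pair i k)) m) ∧
  (∀ a b n m, G (4 * Nat.pair a b + 8) n m ↔
    G a (Nat.pair n m) 0 ∧ ∀ j, j < m → ∃ k, G a (Nat.pair n j) (k + 1))

theorem isOracleEvaluation_oracleEval (y : Baire) :
    IsOracleEvaluation y (fun e n m => m ∈ oracleEval y e n) := by
  refine ⟨?_, ?_, ?_, ?_, ?_, ?_, ?_, ?_, ?_, ?_⟩
  · intro n m; beta_reduce; rw [oracleEval]; simp
  · intro n m; beta_reduce; rw [oracleEval]; simp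
  · intro n m; beta_reduce; rw [oracleEval]; simp
  · intro n m; beta_reduce; rw [oracleEval]; simp
  · intro n m; beta_reduce; rw [oracleEval]; simp [eq_comm]
  · intro a b n m
    simp only [oracleEval_pair, Part.mem_bind_iff, Part.mem_map_iff]
    constructor
    · rintro ⟨_, ⟨i, hi, rfl⟩, j, hj, rfl⟩
      simpa using ⟨hi, hj⟩
    · rintro ⟨hi, hj⟩
      exact ⟨_, ⟨_, hi, rfl⟩, _, hj, Nat.pair_unpair m⟩
  · intro a b n m
    simp only [oracleEval_comp, Part.mem_bind_iff]
  · intro a b n m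
    simp [oracleEval_prec]
  · intro a b n i m
    simp [oracleEval_prec]
  · intro a b n m
    beta_reduce
    rw [oracleEval_rfind]
    refine Nat.mem_rfind.trans (and_congr ((Part.mem_map_iff _).trans (by simp))
      (forall_congr' fun j => imp_congr_right fun _ => (Part.mem_map_iff _).trans ?_))
    constructor
    · rintro ⟨k, hk, hk0⟩
      obtain ⟨k, rfl⟩ := Nat.exists_eq_succ_of_ne_zero (of_decide_eq_false hk0)
      exact ⟨k, hk⟩
    · rintro ⟨k, hk⟩
      exact ⟨k + 1, hk, by simp⟩

theorem IsOracleEvaluation.unique {y : Baire} {G H : ℕ → ℕ → ℕ → Prop}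
    (hG : IsOracleEvaluation y G) (hH : IsOracleEvaluation y H) : G = H := by
  obtain ⟨G0, G1, G2, G3, G4, G5, G6, G7, G7', G8⟩ := hG
  obtain ⟨H0, H1, H2, H3, H4, H5, H6, H7, H7', H8⟩ := hH
  funext e
  induction e using oracle_index_induction with
  | h e he =>
    funext n m
    rw [eq_iff_iff]
    interval_cases e
    exacts [(G0 n m).trans (H0 n m).symm, (G1 n m).trans (H1 n m).symm,
      (G2 n m).trans (H2 n m).symm, (G3 n m).trans (H3 n m).symm, (G4 n m).trans (H4 n m).symm]
  | h' a b ha hb =>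
    refine ⟨?_, ?_, ?_, ?_⟩
    · funext n m; rw [eq_iff_iff, G5, H5, ha, hb]
    · funext n m; rw [eq_iff_iff, G6, H6, ha, hb]
    · have key : ∀ n i m, G (4 * Nat.pair a b + 7) (Nat.pair n i) m ↔
          H (4 * Nat.pair a b + 7) (Nat.pair n i) m := by
        intro n i
        induction i with
        | zero => intro m; rw [G7, H7, ha]
        | succ i ih => intro m; rw [G7', H7', hb]; simp only [ih]
      funext n m
      rw [eq_iff_iff, ← Nat.pair_unpair n]
      exact key _ _ _
    · funext n m; rw [eq_iff_iff, G8, H8, ha]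

/-- The ternary relation coded by a real. -/
def codedRel (g : Baire) (e n m : ℕ) : Prop := g (Nat.pair e (Nat.pair n m)) = 1

theorem exists_codedRel (G : ℕ → ℕ → ℕ → Prop) : ∃ g, codedRel g = G := by
  classical
  refine ⟨fun k => if G k.unpair.1 k.unpair.2.unpair.1 k.unpair.2.unpair.2 then 1 else 0, ?_⟩
  funext e n m
  simp [codedRel]

theorem turingLE_iff_of_isOracleEvaluation {x y : Baire} {G : ℕ → ℕ → ℕ → Prop}
    (hG : IsOracleEvaluation y G) : TuringLE x y ↔ ∃ e, ∀ n m, x n = m → G e n m := by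
  rw [hG.unique (isOracleEvaluation_oracleEval y)]
  refine (RecursiveIn.iff_nat.trans (recursiveIn_iff_exists_oracleEval y _)).trans ?_
  refine exists_congr fun e => ?_
  simp only [forall_eq', funext_iff, Part.eq_some_iff]

theorem turingLE_iff {x y : Baire} : TuringLE x y ↔
    ∃ g, IsOracleEvaluation y (codedRel g) ∧ ∃ e, ∀ n m, x n = m → codedRel g e n m := by
  constructor
  · intro h
    obtain ⟨g, hg⟩ := exists_codedRel (fun e n m => m ∈ oracleEval y e n)
    have hG : IsOracleEvaluation y (codedRel g) := hg ▸ isOracleEvaluation_oracleEval y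
    exact ⟨g, hG, (turingLE_iff_of_isOracleEvaluation hG).1 h⟩
  · rintro ⟨g, hG, h⟩
    exact (turingLE_iff_of_isOracleEvaluation hG).2 h

theorem not_turingLE_iff {x y : Baire} : ¬ TuringLE x y ↔
    ∃ g, IsOracleEvaluation y (codedRel g) ∧ ¬ ∃ e, ∀ n m, x n = m → codedRel g e n m := by
  constructor
  · intro h
    obtain ⟨g, hg⟩ := exists_codedRel (fun e n m => m ∈ oracleEval y e n)
    have hG : IsOracleEvaluation y (codedRel g) := hg ▸ isOracleEvaluation_oracleEval y
    exact ⟨g, hG, (turingLE_iff_of_isOracleEvaluation hG).not.1 h⟩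
  · rintro ⟨g, hG, h⟩
    exact (turingLE_iff_of_isOracleEvaluation hG).not.2 h

theorem deltaOneOne_codedRel {α : Type} [Primcodable α] {e n m : α → ℕ} (he : Primrec e)
    (hn : Primrec n) (hm : Primrec m) :
    DeltaOneOne (fun a w => codedRel (rightHalf w) (e a) (n a) (m a)) :=
  deltaOneOne_apply_eq (f := fun a => 2 * Nat.pair (e a) (Nat.pair (n a) (m a)) + 1)
    (g := fun _ => 1) (by fun_prop) (by fun_prop)

theorem deltaOneOne_isOracleEvaluation : DeltaOneOne (fun (_ : Unit) w =>
    IsOracleEvaluation (rightHalf (leftHalf w)) (codedRel (rightHalf w))) := by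
  unfold IsOracleEvaluation
  refine .and ?_ <| .and ?_ <| .and ?_ <| .and ?_ <| .and ?_ <| .and ?_ <| .and ?_ <| .and ?_ <|
    .and ?_ ?_
  · exact .forall_nat <| .forall_nat <|
      (deltaOneOne_codedRel (by fun_prop) (by fun_prop) (by fun_prop)).iff
      (.eq (by fun_prop) (by fun_prop))
  · exact .forall_nat <| .forall_nat <|
      (deltaOneOne_codedRel (by fun_prop) (by fun_prop) (by fun_prop)).iff
      (.eq (by fun_prop) (by fun_prop))
  · exact .forall_nat <| .forall_nat <|
      (deltaOneOne_codedRel (by fun_prop) (by fun_prop) (by fun_prop)).iff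
      (.eq (by fun_prop) (by fun_prop))
  · exact .forall_nat <| .forall_nat <|
      (deltaOneOne_codedRel (by fun_prop) (by fun_prop) (by fun_prop)).iff
      (.eq (by fun_prop) (by fun_prop))
  · exact .forall_nat <| .forall_nat <|
      (deltaOneOne_codedRel (by fun_prop) (by fun_prop) (by fun_prop)).iff
      (deltaOneOne_apply_eq (f := fun q : (Unit × ℕ) × ℕ => 2 * (2 * q.1.2 + 1)) (by fun_prop)
        (by fun_prop))
  · exact .forall_nat <| .forall_nat <| .forall_nat <| .forall_nat <|
      (deltaOneOne_codedRel (by fun_prop) (by fun_prop) (by fun_prop)).iff <|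
      (deltaOneOne_codedRel (by fun_prop) (by fun_prop) (by fun_prop)).and
      (deltaOneOne_codedRel (by fun_prop) (by fun_prop) (by fun_prop))
  · exact .forall_nat <| .forall_nat <| .forall_nat <| .forall_nat <|
      (deltaOneOne_codedRel (by fun_prop) (by fun_prop) (by fun_prop)).iff <| .exists_nat <|
      (deltaOneOne_codedRel (by fun_prop) (by fun_prop) (by fun_prop)).and
      (deltaOneOne_codedRel (by fun_prop) (by fun_prop) (by fun_prop))
  · exact .forall_nat <| .forall_nat <| .forall_nat <| .forall_nat <|
      (deltaOneOne_codedRel (by fun_prop) (by fun_prop) (by fun_prop)).iff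
      (deltaOneOne_codedRel (by fun_prop) (by fun_prop) (by fun_prop))
  · exact .forall_nat <| .forall_nat <| .forall_nat <| .forall_nat <| .forall_nat <|
      (deltaOneOne_codedRel (by fun_prop) (by fun_prop) (by fun_prop)).iff <| .exists_nat <|
      (deltaOneOne_codedRel (by fun_prop) (by fun_prop) (by fun_prop)).and
      (deltaOneOne_codedRel (by fun_prop) (by fun_prop) (by fun_prop))
  · exact .forall_nat <| .forall_nat <| .forall_nat <| .forall_nat <|
      (deltaOneOne_codedRel (by fun_prop) (by fun_prop) (by fun_prop)).iff <|
      (deltaOneOne_codedRel (by fun_prop) (by fun_prop) (by fun_prop)).and <| .forall_nat <|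
      (DeltaOneOne.of_primrecPred (primrecPred_lt (by fun_prop) (by fun_prop))).imp <|
      .exists_nat <| deltaOneOne_codedRel (by fun_prop) (by fun_prop) (by fun_prop)

theorem deltaOneOne_turingLE : DeltaOneOne (fun (_ : Unit) w =>
    TuringLE (leftHalf w) (rightHalf w)) := by
  have key : DeltaOneOne (fun (_ : Unit) w =>
      ∃ e, ∀ n m, leftHalf (leftHalf w) n = m → codedRel (rightHalf w) e n m) :=
    .exists_nat <| .forall_nat <| .forall_nat <|
      (deltaOneOne_apply_eq (f := fun q : ((Unit × ℕ) × ℕ) × ℕ => 2 * (2 * q.1.2)) (by fun_prop)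
        (by fun_prop)).imp <|
      deltaOneOne_codedRel (by fun_prop) (by fun_prop) (by fun_prop)
  exact ⟨(SigmaOneOne.exists_real (p := fun (_ : Unit) w g =>
      IsOracleEvaluation (rightHalf w) (codedRel g) ∧
        ∃ e, ∀ n m, leftHalf w n = m → codedRel g e n m)
      (deltaOneOne_isOracleEvaluation.and key).1).of_iff fun _ _ => turingLE_iff,
    (SigmaOneOne.exists_real (p := fun (_ : Unit) w g =>
      IsOracleEvaluation (rightHalf w) (codedRel g) ∧
        ¬ ∃ e, ∀ n m, leftHalf w n = m → codedRel g e n m)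
      (deltaOneOne_isOracleEvaluation.and key.not).1).of_iff fun _ _ => not_turingLE_iff⟩

theorem deltaOneOne_turingLE_comp {f g : ℕ → ℕ} (hf : Primrec f) (hg : Primrec g) :
    DeltaOneOne (fun (_ : Unit) w => TuringLE (fun n => w (f n)) (fun n => w (g n))) := by
  refine (deltaOneOne_turingLE.subst (f := fun u : Unit => u) (by fun_prop)
    (g := fun q => if q.2 % 2 = 0 then f (q.2 / 2) else g (q.2 / 2)) (by fun_prop)).of_iff ?_
  intro _ w
  have hl : leftHalf (fun n => w (if n % 2 = 0 then f (n / 2) else g (n / 2))) =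
      fun n => w (f n) := by
    funext n; simp [leftHalf]
  have hr : rightHalf (fun n => w (if n % 2 = 0 then f (n / 2) else g (n / 2))) =
      fun n => w (g n) := by
    funext n
    have h1 : (2 * n + 1) % 2 = 1 := by omega
    have h2 : (2 * n + 1) / 2 = n := by omega
    simp [rightHalf, h1, h2]
  rw [hl, hr]

/-! ### Borel codes of recursive rank -/

/-- The place in `c` of the value at `m` of the iterated subcode of `c` with path `v`, last step
first. -/
def codePos (v : List ℕ) (m : ℕ) : ℕ := v.foldl (fun m i => Nat.pair i m + 1) m

/-- The iterated subcode of `c` with path `v`, last step first. -/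
def subcodeAt (c : Baire) (v : List ℕ) : Baire := fun m => c (codePos v m)

theorem primrec_codePos {α : Type} [Primcodable α] {f : α → List ℕ} {g : α → ℕ} (hf : Primrec f)
    (hg : Primrec g) : Primrec (fun a => codePos (f a) (g a)) :=
  Primrec.list_foldl (h := fun _ q => Nat.pair q.2 q.1 + 1) hf hg
    (show Primrec (fun q : α × (ℕ × ℕ) => Nat.pair q.2.2 q.2.1 + 1) by fun_prop)

attribute [fun_prop] primrec_codePos

theorem isSigmaCode_iff {ξ : Ordinal.{0}} {c : Baire} {A : Set ℕ} : IsSigmaCode ξ c A ↔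
    (ξ = 1 ∧ c 0 = 0 ∧ A = {n | ∃ i, c (i + 1) = n + 1}) ∨
    (c 0 ≠ 0 ∧ ∃ (η : ℕ → Ordinal.{0}) (B : ℕ → Set ℕ), (∀ i, η i < ξ) ∧
      (∀ i, IsSigmaCode (η i) (subcode c i) (B i)) ∧ A = ⋃ i, (B i)ᶜ) := by
  constructor
  · intro h
    cases h with
    | enum _ h => exact Or.inl ⟨rfl, h, rfl⟩
    | union _ _ η B h hη hB => exact Or.inr ⟨h, η, B, hη, hB, rfl⟩
  · rintro (⟨rfl, h, rfl⟩ | ⟨h, η, B, hη, hB, rfl⟩)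
    · exact .enum c h
    · exact .union ξ c η B h hη hB

/-- The set coded by a Borel code does not depend on the level assigned to the code. -/
theorem IsSigmaCode.unique {ξ : Ordinal.{0}} {c : Baire} {A : Set ℕ} (hA : IsSigmaCode ξ c A) :
    ∀ {ζ : Ordinal.{0}} {B : Set ℕ}, IsSigmaCode ζ c B → A = B := by
  induction hA with
  | enum c h =>
    intro ζ B hB
    rcases isSigmaCode_iff.1 hB with ⟨-, -, rfl⟩ | ⟨h', -⟩
    · rfl
    · exact absurd h h'
  | union ξ c η B h hη hB ih =>
    intro ζ B' hB'
    rcases isSigmaCode_iff.1 hB' with ⟨-, h', -⟩ | ⟨-, η', C, -, hC, rfl⟩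
    · exact absurd h' h
    · exact Set.iUnion_congr fun i => congrArg _ (ih i (hC i))

/-- The least level at which `c` is a Borel code. -/
noncomputable def codeRank (c : Baire) : Ordinal.{0} := sInf {ξ | ∃ A, IsSigmaCode ξ c A}

theorem IsSigmaCode.codeRank_le {ξ : Ordinal.{0}} {c : Baire} {A : Set ℕ}
    (h : IsSigmaCode ξ c A) : codeRank c ≤ ξ := csInf_le' ⟨A, h⟩

theorem IsSigmaCode.at_codeRank {ξ : Ordinal.{0}} {c : Baire} {A : Set ℕ}
    (h : IsSigmaCode ξ c A) : IsSigmaCode (codeRank c) c A := by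
  obtain ⟨B, hB⟩ := csInf_mem (s := {ξ | ∃ A, IsSigmaCode ξ c A}) ⟨ξ, A, h⟩
  exact h.unique hB ▸ hB

/-- The label function `l` and the relation `E` describe an evaluation of the Borel code `c`: the
label `0` marks a path outside the part considered, and a label `d + 1` is the level `d`, an
element of the recursive well-ordering `r` of `D` with second element `one`, of a subcode `v` that
codes the set `E v`. -/
def IsCodeEvaluation (D : ℕ → Prop) (r : ℕ → ℕ → Prop) (one : ℕ) (c : Baire) (l : List ℕ → ℕ)
    (E : List ℕ → ℕ → Prop) : Prop :=
  ∀ v, l v = 0 ∨ ∃ d, l v = d + 1 ∧ D d ∧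
    ((c (codePos v 0) = 0 ∧ d = one ∧ ∀ n, E v n ↔ ∃ i, c (codePos v (i + 1)) = n + 1) ∨
    (¬ c (codePos v 0) = 0 ∧ (∀ i, ∃ d', l (i :: v) = d' + 1 ∧ D d' ∧ r d' d) ∧
      ∀ n, E v n ↔ ∃ i, ¬ E (i :: v) n))

section RecursiveOrdinal

variable {D : ℕ → Prop} {r : ℕ → ℕ → Prop}
  [IsWellOrder {n : ℕ // D n} (fun a b => r a b)]

theorem IsCodeEvaluation.isSigmaCode {one : {n // D n}}
    (hone : Ordinal.typein (fun a b : {n // D n} => r a b) one = 1) {c : Baire} {l : List ℕ → ℕ}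
    {E : List ℕ → ℕ → Prop} (h : IsCodeEvaluation D r one c l E) (d : {n // D n}) :
    ∀ v, l v = d + 1 → IsSigmaCode (Ordinal.typein (fun a b : {n // D n} => r a b) d)
      (subcodeAt c v) {n | E v n} := by
  induction d using (IsWellFounded.wf (r := fun a b : {n // D n} => r a b)).induction with
  | _ d ih =>
    intro v hv
    rcases h v with h0 | ⟨e, he, -, hleaf | hnode⟩
    · omega
    · obtain ⟨hc, hd, hE⟩ := hleaf
      obtain rfl : d = one := Subtype.ext (by omega)
      rw [hone, Set.ext hE]
      exact .enum (subcodeAt c v) hc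
    · obtain ⟨hc, hd, hE⟩ := hnode
      obtain rfl : (d : ℕ) = e := by omega
      choose d' hd' hD hr using hd
      have hset : {n | E v n} = ⋃ i, {n | E (i :: v) n}ᶜ := by
        ext n; simpa using hE n
      rw [hset]
      exact .union _ _ (fun i => Ordinal.typein (fun a b : {n // D n} => r a b) ⟨d' i, hD i⟩) _ hc
        (fun i => (Ordinal.typein_lt_typein _).2 (hr i)) fun i => ih ⟨d' i, hD i⟩ (hr i) _ (hd' i)

theorem isSigmaCode_iff_exists_isCodeEvaluation {one : {n // D n}}
    (hone : Ordinal.typein (fun a b : {n // D n} => r a b) one = 1) {ρ : Ordinal.{0}}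
    (htype : Ordinal.type (fun a b : {n // D n} => r a b) = ρ) (h2 : 2 ≤ ρ) {c : Baire}
    {A : Set ℕ} :
    IsSigmaCode ρ c A ↔ ¬ c 0 = 0 ∧ ∃ (l : List ℕ → ℕ) (E : List ℕ → ℕ → Prop),
      IsCodeEvaluation D r one c l E ∧ (∀ i, ¬ l [i] = 0) ∧ ∀ n, n ∈ A ↔ ∃ i, ¬ E [i] n := by
  classical
  subst htype
  constructor
  · intro h
    rcases isSigmaCode_iff.1 h with ⟨h1, -⟩ | ⟨hc, η, B, hη, hB, rfl⟩
    · rw [h1] at h2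
      exact absurd h2 (by simp)
    -- Subcodes get their least levels as labels.
    let lab : Baire → ℕ := fun c => if h : codeRank c < Ordinal.type (fun a b : {n // D n} => r a b)
      then (Ordinal.enum (fun a b : {n // D n} => r a b) ⟨codeRank c, h⟩ : {n // D n}) + 1 else 0
    let l : List ℕ → ℕ := fun v =>
      if ∃ ξ < Ordinal.type (fun a b : {n // D n} => r a b), ∃ A, IsSigmaCode ξ (subcodeAt c v) A
        then lab (subcodeAt c v) else 0
    let E : List ℕ → ℕ → Prop := fun v n => ∃ ξ A, IsSigmaCode ξ (subcodeAt c v) A ∧ n ∈ A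
    have hE : ∀ {v ξ A}, IsSigmaCode ξ (subcodeAt c v) A → ∀ n, E v n ↔ n ∈ A := by
      intro v ξ A h n
      exact ⟨fun ⟨_, A', h', hn⟩ => h.unique h' ▸ hn, fun hn => ⟨ξ, A, h, hn⟩⟩
    have hl : ∀ {v ξ A}, ξ < Ordinal.type (fun a b : {n // D n} => r a b) →
        IsSigmaCode ξ (subcodeAt c v) A → ∃ d : {n // D n}, l v = d + 1 ∧
          Ordinal.typein (fun a b : {n // D n} => r a b) d = codeRank (subcodeAt c v) := by
      intro v ξ A hξ h
      have hlt := h.codeRank_le.trans_lt hξ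
      refine ⟨Ordinal.enum (fun a b : {n // D n} => r a b) ⟨_, hlt⟩, ?_, Ordinal.typein_enum _ hlt⟩
      simp only [l]
      rw [if_pos ⟨ξ, hξ, A, h⟩]
      exact dif_pos hlt
    refine ⟨hc, l, E, fun v => ?_, fun i => ?_, fun n => ?_⟩
    · by_cases hv : ∃ ξ < Ordinal.type (fun a b : {n // D n} => r a b),
        ∃ A, IsSigmaCode ξ (subcodeAt c v) A
      · right
        obtain ⟨ξ, hξ, A, hA⟩ := hv
        obtain ⟨d, hd, hdr⟩ := hl hξ hA
        have hlt := hA.codeRank_le.trans_lt hξ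
        refine ⟨d, hd, d.2, ?_⟩
        rcases isSigmaCode_iff.1 hA.at_codeRank with ⟨h1, h0, hA'⟩ | ⟨h0, η, B, hη, hB, hA'⟩
        · refine Or.inl ⟨h0, ?_, fun n => ?_⟩
          · rw [h1, ← hone, Ordinal.typein_inj] at hdr
            exact congrArg Subtype.val hdr
          · rw [hE hA, hA']
            rfl
        · refine Or.inr ⟨h0, fun i => ?_, fun n => ?_⟩
          · obtain ⟨d', hd', hdr'⟩ := hl (v := i :: v) ((hη i).trans hlt) (hB i)
            refine ⟨d', hd', d'.2, ?_⟩
            rw [← Ordinal.typein_lt_typein (fun a b : {n // D n} => r a b), hdr, hdr']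
            exact (IsSigmaCode.codeRank_le (hB i)).trans_lt (hη i)
          · rw [hE hA, hA', Set.mem_iUnion]
            exact exists_congr fun i => not_congr (hE (v := i :: v) (hB i) n).symm
      · exact Or.inl (if_neg hv)
    · obtain ⟨d, hd, -⟩ := hl (v := [i]) (hη i) (hB i)
      omega
    · rw [Set.mem_iUnion]
      exact exists_congr fun i => not_congr (hE (v := [i]) (hB i) n).symm
  · rintro ⟨hc, l, E, hE, hl, hA⟩
    have hd : ∀ i, ∃ d : {n // D n}, l [i] = d + 1 := fun i => by
      rcases hE [i] with h0 | ⟨d, hd, hD, -⟩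
      · exact absurd h0 (hl i)
      · exact ⟨⟨d, hD⟩, hd⟩
    choose d hd using hd
    have hset : A = ⋃ i, {n | E [i] n}ᶜ := by
      ext n; simpa using hA n
    rw [hset]
    exact .union _ _ (fun i => Ordinal.typein (fun a b : {n // D n} => r a b) (d i)) _ hc
      (fun i => Ordinal.typein_lt_type _ _) fun i => hE.isSigmaCode hone (d i) [i] (hd i)

end RecursiveOrdinal

theorem deltaOneOne_isCodeEvaluation {D : ℕ → Prop} {r : ℕ → ℕ → Prop} (hD : ComputablePred D)
    (hr : ComputablePred (fun p : ℕ × ℕ => r p.1 p.2)) (one : ℕ) :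
    DeltaOneOne (fun (_ : Unit) w => IsCodeEvaluation D r one (rightHalf (leftHalf (leftHalf w)))
      (fun v => rightHalf (leftHalf w) (encode v))
      (fun v n => rightHalf w (Nat.pair (encode v) n) = 1)) := by
  -- Atomic formulas on the relation `E`, the labels, the code and the well-ordering.
  have hE : ∀ {α : Type} [Primcodable α] {v : α → List ℕ} {n : α → ℕ}, Primrec v → Primrec n →
      DeltaOneOne (fun a w => rightHalf w (Nat.pair (encode (v a)) (n a)) = 1) :=
    fun {α} _ {v} {n} hv hn => deltaOneOne_apply_eq
      (f := fun a => 2 * Nat.pair (encode (v a)) (n a) + 1) (by fun_prop) (by fun_prop)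
  have hl : ∀ {α : Type} [Primcodable α] {v : α → List ℕ} {n : α → ℕ}, Primrec v → Primrec n →
      DeltaOneOne (fun a w => rightHalf (leftHalf w) (encode (v a)) = n a) :=
    fun {α} _ {v} {n} hv hn => deltaOneOne_apply_eq (f := fun a => 2 * (2 * encode (v a) + 1))
      (by fun_prop) hn
  have hc : ∀ {α : Type} [Primcodable α] {m n : α → ℕ}, Primrec m → Primrec n →
      DeltaOneOne (fun a w => rightHalf (leftHalf (leftHalf w)) (m a) = n a) :=
    fun {α} _ {m} {n} hm hn => deltaOneOne_apply_eq (f := fun a => 2 * (2 * (2 * m a + 1)))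
      (by fun_prop) hn
  have hD' : ∀ {α : Type} [Primcodable α] {m : α → ℕ}, Primrec m →
      DeltaOneOne (fun a (_ : Baire) => D (m a)) :=
    fun hm => (DeltaOneOne.of_rePred hD.to_re).subst hm (g := fun q => q.2) (by fun_prop)
  have hr' : ∀ {α : Type} [Primcodable α] {m n : α → ℕ}, Primrec m → Primrec n →
      DeltaOneOne (fun a (_ : Baire) => r (m a) (n a)) :=
    fun {α} _ {m} {n} hm hn => (DeltaOneOne.of_rePred hr.to_re).subst
      (f := fun a => (m a, n a)) (by fun_prop) (g := fun q => q.2) (by fun_prop)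
  unfold IsCodeEvaluation
  refine .forall_primcodable <| .or (hl (by fun_prop) (by fun_prop)) <| .exists_nat <|
    .and (hl (by fun_prop) (by fun_prop)) <| .and (hD' (by fun_prop)) <| .or ?_ ?_
  · exact .and (hc (by fun_prop) (by fun_prop)) <| .and (.eq (by fun_prop) (by fun_prop)) <|
      .forall_nat <| .iff (hE (by fun_prop) (by fun_prop)) <| .exists_nat <|
      hc (by fun_prop) (by fun_prop)
  · exact .and (hc (by fun_prop) (by fun_prop)).not <| .and
      (.forall_nat <| .exists_nat <| .and (hl (by fun_prop) (by fun_prop)) <|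
        .and (hD' (by fun_prop)) (hr' (by fun_prop) (by fun_prop)))
      (.forall_nat <| .iff (hE (by fun_prop) (by fun_prop)) <| .exists_nat <|
        (hE (by fun_prop) (by fun_prop)).not)

/-- For recursive `ρ ≥ 2`, being `Σ⁰_ρ` in a real is a `Σ¹₁` condition: it asks for a code and for
an evaluation of that code with levels in a recursive well-ordering of type `ρ`. -/
theorem sigmaOneOne_isSigma0In {ρ : Ordinal.{0}} (h2 : 2 ≤ ρ) (hρ : IsRecursiveOrdinal ρ)
    {A : Baire → Set ℕ} (hA : DeltaOneOne (fun (n : ℕ) w => n ∈ A w)) {g : ℕ → ℕ}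
    (hg : Primrec g) :
    SigmaOneOne (fun (_ : Unit) w => IsSigma0In ρ (fun n => w (g n)) (A w)) := by
  obtain ⟨D, r, hD, hr, hwo, htype⟩ := hρ
  have h1 : (1 : Ordinal) < Ordinal.type (fun a b : {n // D n} => r a b) := by
    rw [htype]
    exact lt_of_lt_of_le one_lt_two h2
  obtain ⟨one, hone⟩ : ∃ one, Ordinal.typein (fun a b : {n // D n} => r a b) one = 1 :=
    ⟨_, Ordinal.typein_enum _ h1⟩
  refine (SigmaOneOne.exists_real (p := fun (_ : Unit) w c => TuringLE c (fun n => w (g n)) ∧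
    ¬ c 0 = 0 ∧ ∃ l E : Baire, IsCodeEvaluation D r one c (fun v => l (encode v))
      (fun v n => E (Nat.pair (encode v) n) = 1) ∧ (∀ i : ℕ, ¬ l (encode [i]) = 0) ∧
      ∀ n, n ∈ A w ↔ ∃ i : ℕ, ¬ E (Nat.pair (encode [i]) n) = 1) ?_).of_iff ?_
  · refine .and (deltaOneOne_turingLE_comp (f := fun n => 2 * n + 1) (g := fun n => 2 * g n)
      (by fun_prop) (by fun_prop)).1 <| .and (deltaOneOne_apply_eq (f := fun _ => 2 * 0 + 1)
      (by fun_prop) (by fun_prop)).not.1 <| .exists_real <| .exists_real <| And.left <|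
      (deltaOneOne_isCodeEvaluation hD hr one).and <| .and ?_ ?_
    · exact .forall_nat (deltaOneOne_apply_eq (f := fun q : Unit × ℕ => 2 * (2 * encode [q.2] + 1))
        (by fun_prop) (by fun_prop)).not
    · exact .forall_nat <| .iff (hA.subst (f := fun q : Unit × ℕ => q.2) (by fun_prop)
        (g := fun q => 2 * (2 * (2 * q.2))) (by fun_prop)) <| .exists_nat
        (deltaOneOne_apply_eq
          (f := fun q : (Unit × ℕ) × ℕ => 2 * Nat.pair (encode [q.2]) q.1.2 + 1)
          (by fun_prop) (by fun_prop)).not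
  · intro _ w
    refine exists_congr fun c => and_congr_right fun _ => ?_
    rw [isSigmaCode_iff_exists_isCodeEvaluation hone htype h2]
    refine and_congr_right fun _ => ?_
    constructor
    · classical
      rintro ⟨l, E, h⟩
      refine ⟨fun k => l ((decode k).getD []), fun k =>
        if E ((decode k.unpair.1).getD []) k.unpair.2 then 1 else 0, ?_⟩
      simpa using h
    · rintro ⟨l, E, h⟩
      exact ⟨_, _, h⟩

theorem sigmaOneOne_isDelta0In {ρ : Ordinal.{0}} (h2 : 2 ≤ ρ) (hρ : IsRecursiveOrdinal ρ)
    {f g : ℕ → ℕ} (hf : Primrec f) (hg : Primrec g) :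
    SigmaOneOne (fun (_ : Unit) w =>
      IsDelta0In ρ (fun n => w (g n)) (graph (fun n => w (f n)))) := by
  have hgraph : DeltaOneOne (fun (n : ℕ) w => n ∈ graph (fun n => w (f n))) :=
    deltaOneOne_apply_eq (f := fun n : ℕ => f n.unpair.1) (g := fun n => n.unpair.2) (by fun_prop)
      (by fun_prop)
  exact (sigmaOneOne_isSigma0In h2 hρ hgraph hg).and
    (sigmaOneOne_isSigma0In h2 hρ hgraph.not hg)

theorem isRecursiveOrdinal_of_lt_omega1CK {ρ : Ordinal.{0}} (hρ : ρ < omega1CK) :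
    IsRecursiveOrdinal ρ := by
  by_contra h
  exact absurd hρ (not_lt.2 (csInf_le' h))

/-! ### Reflection -/

/-- A `Σ¹₁` set without pairs in a symmetric `Σ¹₁` relation is contained in a `Δ¹₁` set without
such pairs: separate twice, first from the points related to the set, then from the points related
to the separating set. -/
theorem exists_isDelta11_superset {A : Set Baire} (hA : IsSigma11 A) {R : Baire → Baire → Prop}
    (hR : SigmaOneOne (fun (_ : Unit) w => R (leftHalf w) (rightHalf w)))
    (hsymm : ∀ x y, R x y → R y x) (hAR : ∀ x ∈ A, ∀ y ∈ A, ¬ R x y) :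
    ∃ B, IsDelta11 B ∧ A ⊆ B ∧ ∀ x ∈ B, ∀ y ∈ B, ¬ R x y := by
  have hA' := hA.sigmaOneOne
  have related : ∀ {p : Baire → Prop}, SigmaOneOne (fun (_ : Unit) x => p x) →
      SigmaOneOne (fun (_ : Unit) x => ∃ y, p y ∧ R x y) := fun hp =>
    .exists_real <| (hp.subst (f := fun u : Unit => u) (by fun_prop) (g := fun q => 2 * q.2 + 1)
      (by fun_prop)).and hR
  obtain ⟨C, hC, hAC, hC'⟩ := hA'.exists_separation (related hA')
    fun x hx ⟨y, hy, hxy⟩ => hAR x hx y hy hxy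
  obtain ⟨D, hD, hAD, hD'⟩ := hA'.exists_separation (related hC.1)
    fun x hx ⟨y, hy, hxy⟩ => hC' y ⟨x, hx, hsymm x y hxy⟩ hy
  have hB : DeltaOneOne (fun (_ : Unit) x => x ∈ {x | C x ∧ D x}) := hC.and hD
  exact ⟨{x | C x ∧ D x}, ⟨hB.1.isSigma11, hB.2.isSigma11⟩, fun x hx => ⟨hAC x hx, hAD x hx⟩,
    fun x hx y hy hxy => hD' x ⟨y, hy.1, hxy⟩ hx.2⟩

end WeakTuring

theorem mainTheorem5 (ρ : Ordinal.{0}) (h2 : 2 ≤ ρ) (hρ : ρ < WeakTuring.omega1CK)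
    (h : WeakTuring.WeakTuringDet ρ WeakTuring.IsDelta11) :
    WeakTuring.WeakTuringDet ρ WeakTuring.IsSigma11 := by
  intro A hA hcof
  by_contra hcon
  have hrec := WeakTuring.isRecursiveOrdinal_of_lt_omega1CK hρ
  obtain ⟨B, hB, hAB, hBR⟩ := WeakTuring.exists_isDelta11_superset hA
    (R := fun x y => ¬ WeakTuring.TuringEq x y ∧ WeakTuring.DeltaEquiv ρ x y)
    ((((WeakTuring.deltaOneOne_turingLE_comp (f := fun n => 2 * n) (g := fun n => 2 * n + 1)
        (by fun_prop) (by fun_prop)).and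
      (WeakTuring.deltaOneOne_turingLE_comp (f := fun n => 2 * n + 1) (g := fun n => 2 * n)
        (by fun_prop) (by fun_prop))).2).and
      ((WeakTuring.sigmaOneOne_isDelta0In h2 hrec (f := fun n => 2 * n) (g := fun n => 2 * n + 1)
        (by fun_prop) (by fun_prop)).and
      (WeakTuring.sigmaOneOne_isDelta0In h2 hrec (f := fun n => 2 * n + 1) (g := fun n => 2 * n)
        (by fun_prop) (by fun_prop))))
    (fun x y hxy => ⟨fun e => hxy.1 e.symm, hxy.2.symm⟩)
    (fun x hx y hy hxy => hcon ⟨x, hx, y, hy, hxy.1, hxy.2⟩)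
  obtain ⟨x, hx, y, hy, hxy⟩ := h B hB fun x => (hcof x).imp fun y hy => ⟨hAB hy.1, hy.2⟩
  exact hBR x hx y hy hxy
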